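/- Let $n\ge 1$ and let $\mathbf d=(d_1,\dots,d_{2n})$ be a minimal generating system of a numerical semigroup $S=\{\sum x_id_i : x_i\in\mathbb Z_{\ge 0}\}$, i.e. $\gcd(d_1,\dots,d_{2n})=1$ and no $d_i$ is a non-negative integer combination of the others (so $2n$ is the embedding dimension of $S$). Let $c$ be the conductor of $S$ (the least integer $c\ge 0$ such that all integers $\ge c$ belong to $S$), $F=c-1$ its Frobenius number, $\Sigma=d_1+\dots+d_{2n}$, and put $$\Delta_{\mathcal H}=\{h\in\mathbb Z_{\ge 0}\setminus S : F-h\notin S\},\qquad S'=\{f\in\mathbb Z\setminus S : f+s\in S\ \text{for all } s\in S\setminus\{0\}\},\qquad \gamma=\#\Delta_{\mathcal H}.$$ Assume that $S$ is almost symmetric, i.e. $S'\setminus\{F\}=\Delta_{\mathcal H}$. Let $k$ be a field of characteristic $0$, and let $\beta_i$ be the Betti numbers and $C_{j,i}$ ($1\le j\le\beta_i$) the syzygy degrees of the semigroup ring $k[z^{d_1},\dots,z^{d_{2n}}]$ as a graded module over $k[X_1,\dots,X_{2n}]$, where $\deg X_i=d_i$ and $X_i$ acts as $z^{d_i}$;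 that is, the $i$-th module of a minimal graded free resolution has rank $\beta_i$, with basis elements of degrees $C_{1,i},\dots,C_{\beta_i,i}$. All the following are multisets of integers, with their multiplicities; the intersection $\mathfrak A\wedge\mathfrak B$ of two multisets gives each element the minimum of its two multiplicities, and $\#$ counts elements with multiplicity. Let $\mathfrak L_o$ (resp. $\mathfrak L_e$) be the multiset of all sums $h+\sum_{i\in A}d_i$, one for each $h\in\Delta_{\mathcal H}$ and each $A\subseteq\{1,\dots,2n\}$ of odd cardinality $1\le \#A\le 2n-1$ (resp. of even cardinality $2\le\#A\le 2n-2$). Let $\mathfrak X_1$ (resp. $\mathfrak X_2$) be the multiset consisting of all $C_{j,i}$ and all $F+\Sigma-C_{j,i}$, with $1\le j\le\beta_i$ and $i$ odd, $1\le i\le 2n-3$ (resp. $i$ even, $2\le i\le 2n-2$). Put $$\ell=\#(\mathfrak L_e\wedge\mathfrak L_o),\qquad \wp=\#(\mathfrak X_1\wedge\mathfrak X_2),\qquad \delta=\wp-\ell .$$ Then $$\beta_1+\beta_3+\dots+\beta_{2n-3}=\gamma\,(4^{n-1}-1)+\tfrac12\,\delta,\qquad \beta_2+\beta_4+\dots+\beta_{2n-2}=\gamma\cdot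 4^{n-1}+\tfrac12\,\delta .$$ (For $n=1$ both sums are empty.) -/

import Mathlib

namespace NumSemi

/-- The semigroup `S(d)` of all sums `∑ xᵢ dᵢ` with `xᵢ ∈ ℕ ∪ {0}`. -/
def semigroup {m : ℕ} (d : Fin m → ℕ) : AddSubmonoid ℕ :=
  AddSubmonoid.closure (Set.range d)

/-- `d` is a minimal generating system of a numerical semigroup: the generators have greatest
common divisor `1`, and none of them is a non-negative combination of the others (so they are
positive and pairwise distinct). In this case `m` is the embedding dimension. -/
structure IsMinimalSystem {m : ℕ} (d : Fin m → ℕ) : Prop where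
  gcd_eq_one : Finset.univ.gcd d = 1
  minimal : ∀ i, d i ∉ AddSubmonoid.closure (d '' {j | j ≠ i})

/-- The integer `x` is an element of `S(d)`. -/
def IntMem {m : ℕ} (d : Fin m → ℕ) (x : ℤ) : Prop :=
  ∃ s ∈ semigroup d, (s : ℤ) = x

/-- The conductor: the least `c` such that every `k ≥ c` is in `S(d)`. -/
noncomputable def conductor {m : ℕ} (d : Fin m → ℕ) : ℕ :=
  sInf {c : ℕ | ∀ k, c ≤ k → k ∈ semigroup d}

/-- The Frobenius number `F = c - 1`. -/
noncomputable def frobenius {m : ℕ} (d : Fin m → ℕ) : ℤ :=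
  (conductor d : ℤ) - 1

/-- The sum `Σ` of all generators. -/
def genSum {m : ℕ} (d : Fin m → ℕ) : ℤ :=
  ∑ i, (d i : ℤ)

/-- The set `S'` of the integers `f ∉ S(d)` with `f + s ∈ S(d)` for all `s ∈ S(d) \ {0}`. -/
def pseudoFrobenius {m : ℕ} (d : Fin m → ℕ) : Set ℤ :=
  {f | ¬ IntMem d f ∧ ∀ s ∈ semigroup d, s ≠ 0 → IntMem d (f + s)}

open Classical in
/-- The set `Δ_H` of the gaps `h` for which `F - h` is not in `S(d)` either. All gaps are smaller
than the conductor. -/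
noncomputable def gapsH {m : ℕ} (d : Fin m → ℕ) : Finset ℕ :=
  {h ∈ Finset.range (conductor d) | h ∉ semigroup d ∧ ¬ IntMem d (frobenius d - h)}

/-- `S(d)` is almost symmetric: `S' \ {F} = Δ_H`. -/
def IsAlmostSymmetric {m : ℕ} (d : Fin m → ℕ) : Prop :=
  pseudoFrobenius d \ {frobenius d} = (fun h : ℕ => (h : ℤ)) '' (gapsH d : Set ℕ)

/-- The number `γ = #Δ_H`. -/
noncomputable def gamma {m : ℕ} (d : Fin m → ℕ) : ℕ :=
  (gapsH d).card

/-- The map `k[X₁, …, X_m] → k[z]`, `Xᵢ ↦ z ^ dᵢ`. Its range is the semigroup ring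
`k[z ^ d₁, …, z ^ d_m]`. -/
noncomputable def monomialMap (k : Type*) [Field k] {m : ℕ} (d : Fin m → ℕ) :
    MvPolynomial (Fin m) k →+* Polynomial k :=
  (MvPolynomial.aeval fun i => (Polynomial.X : Polynomial k) ^ d i).toRingHom

/-- A minimal graded free resolution
`⋯ → F₂ → F₁ → F₀ → k[z ^ d₁, …, z ^ d_m] → 0` over `R = k[X₁, …, X_m]`, where `deg Xᵢ = dᵢ`.
The module `Fᵢ` is the free module with basis `e₁, …, e_{βᵢ}`, where `e_j` has degree
`C_{j,i}`. Here `βᵢ` is `betti i` and `C_{j,i}` is `syzDeg i j`. -/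
structure MinimalResolution (k : Type*) [Field k] {m : ℕ} (d : Fin m → ℕ) where
  /-- The Betti numbers. -/
  betti : ℕ → ℕ
  /-- The syzygy degrees. -/
  syzDeg : (i : ℕ) → Fin (betti i) → ℕ
  /-- The differentials `F_{i+1} → F_i`. -/
  diff : (i : ℕ) → (Fin (betti (i + 1)) → MvPolynomial (Fin m) k) →ₗ[MvPolynomial (Fin m) k]
    (Fin (betti i) → MvPolynomial (Fin m) k)
  /-- The augmentation `F₀ → k[z ^ d₁, …, z ^ d_m]`; it is linear over `R`, which acts on `k[z]`
  through `Xᵢ ↦ z ^ dᵢ`. -/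
  aug : (Fin (betti 0) → MvPolynomial (Fin m) k) →ₛₗ[monomialMap k d] Polynomial k
  /-- The augmentation maps onto the semigroup ring. -/
  range_aug : Set.range aug = Set.range (monomialMap k d)
  exact_zero : Function.Exact (diff 0) aug
  exact_succ : ∀ i, Function.Exact (diff (i + 1)) (diff i)
  /-- The augmentation is homogeneous of degree zero. -/
  aug_homogeneous : ∀ j, ∃ a : k, aug (Pi.single j 1) = Polynomial.monomial (syzDeg 0 j) a
  /-- The differentials are homogeneous of degree zero: every monomial that occurs in the
  coordinate of `∂ e_j` at `e_l` has degree `C_{j,i+1} - C_{l,i}`. -/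
  diff_homogeneous : ∀ i j l (u : Fin m →₀ ℕ),
    MvPolynomial.coeff u (diff i (Pi.single j 1) l) ≠ 0 →
      Finsupp.weight d u + syzDeg i l = syzDeg (i + 1) j
  /-- Minimality: the image of `F_{i+1}` lies in `(X₁, …, X_m) F_i`. -/
  minimal : ∀ i j l, MvPolynomial.constantCoeff (diff i (Pi.single j 1) l) = 0

/-- The multiset `𝔇ᵢ` of the sums `d_{j₁} + … + d_{jᵢ}`, one for each set of `i` indices. -/
def genSums {m : ℕ} (d : Fin m → ℕ) (i : ℕ) : Multiset ℤ :=
  (Finset.powersetCard i (Finset.univ : Finset (Fin m))).val.map fun A => ∑ j ∈ A, (d j : ℤ)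

/-- The multiset `𝔏ᵢ` of the sums `x + h` with `x ∈ 𝔇ᵢ` and `h ∈ Δ_H`. -/
noncomputable def shiftedSums {m : ℕ} (d : Fin m → ℕ) (i : ℕ) : Multiset ℤ :=
  (genSums d i ×ˢ (gapsH d).val).map fun p => p.1 + (p.2 : ℤ)

/-- The multiset `𝔏ₒ`, the join of `𝔏₁, 𝔏₃, …, 𝔏_{2⌊m/2⌋-1}`. -/
noncomputable def oddSums {m : ℕ} (d : Fin m → ℕ) : Multiset ℤ :=
  ∑ q ∈ Finset.Icc 1 (m / 2), shiftedSums d (2 * q - 1)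

/-- The multiset `𝔏ₑ`, the join of `𝔏₂, 𝔏₄, …, 𝔏_{2⌊(m-1)/2⌋}`. -/
noncomputable def evenSums {m : ℕ} (d : Fin m → ℕ) : Multiset ℤ :=
  ∑ q ∈ Finset.Icc 1 ((m - 1) / 2), shiftedSums d (2 * q)

/-- The number `ℓ` of elements of `𝔏ₑ ⋀ 𝔏ₒ` (the multiplicity in the intersection is the
minimum of the two multiplicities). -/
noncomputable def ell {m : ℕ} (d : Fin m → ℕ) : ℕ :=
  (evenSums d ∩ oddSums d).card

namespace MinimalResolution

variable {k : Type*} [Field k] {m : ℕ} {d : Fin m → ℕ}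

/-- The multiset `𝔅ᵢ` of the syzygy degrees `C_{j,i}`. -/
def degrees (R : MinimalResolution k d) (i : ℕ) : Multiset ℤ :=
  (Finset.univ : Finset (Fin (R.betti i))).val.map fun j => (R.syzDeg i j : ℤ)

/-- The multiset of the dual degrees `F + Σ - C_{j,i}`. -/
noncomputable def dualDegrees (R : MinimalResolution k d) (i : ℕ) : Multiset ℤ :=
  (R.degrees i).map fun c => frobenius d + genSum d - c

end MinimalResolution

/-- The multiset `𝔛₁` for `m = 2n`: the join of the `𝔅ᵢ` and their duals over the odd indices
`i = 1, 3, …, 2n-3`. -/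
noncomputable def oddDegrees {k : Type*} [Field k] {n : ℕ} {d : Fin (2 * n) → ℕ}
    (R : MinimalResolution k d) : Multiset ℤ :=
  ∑ q ∈ Finset.Icc 1 (n - 1), (R.degrees (2 * q - 1) + R.dualDegrees (2 * q - 1))

/-- The multiset `𝔛₂` for `m = 2n`: the join of the `𝔅ᵢ` and their duals over the even indices
`i = 2, 4, …, 2n-2`. -/
noncomputable def evenDegrees {k : Type*} [Field k] {n : ℕ} {d : Fin (2 * n) → ℕ}
    (R : MinimalResolution k d) : Multiset ℤ :=
  ∑ q ∈ Finset.Icc 1 (n - 1), (R.degrees (2 * q) + R.dualDegrees (2 * q))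

/-- The number `℘` of elements of `𝔛₁ ⋀ 𝔛₂`. -/
noncomputable def wp {k : Type*} [Field k] {n : ℕ} {d : Fin (2 * n) → ℕ}
    (R : MinimalResolution k d) : ℕ :=
  (oddDegrees R ∩ evenDegrees R).card

/-- The number `δ = ℘ - ℓ`. -/
noncomputable def delta {k : Type*} [Field k] {n : ℕ} {d : Fin (2 * n) → ℕ}
    (R : MinimalResolution k d) : ℤ :=
  (wp R : ℤ) - (ell d : ℤ)

end NumSemi

/-! Let `A` be the semigroup ring and `m = 2n`. Multiplying the Hilbert series of `A` by `∏ (1 - z ^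
dᵢ)` gives `K(z) = ∑ (-1)^i z ^ C_{j,i}`. No integer `x` has both `x` and `F - x` in `S`, and
neither lies in `S` exactly when `x ∈ Δ_H`; hence `1_S(x) + 1_S(F - x) = 1 - 1_{Δ_H}(x)` on all of
`ℤ`. Convolving with `∏ (1 - z ^ dᵢ)` kills the constant, turns the reflected term into `K`
reflected in `F + Σ` (the sign `(-1)^m` is `1`), and turns the last term into the alternating sum of
the `𝔏ᵢ`.

The two ends of the resolution are known: `F₀` has the single degree `0`, and the degrees of
`F_{2n-1}` are `f + Σ` for the pseudo-Frobenius numbers `f`, each once. By almost symmetry these `f`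
are `F` and the elements of `Δ_H`, so the end terms cancel against their duals and against `𝔏₀` and
`𝔏_{2n}`. What remains is `𝔛₂ + 𝔏ₑ = 𝔛₁ + 𝔏ₒ` (`evenDegrees_add_oddSums`). Hence `#𝔛₂ - ℘ = #𝔏ₒ - ℓ`
and `#𝔛₁ - ℘ = #𝔏ₑ - ℓ`, and binomial sums evaluate the right-hand sides.

The algebraic input is `betti_eq_zero`, `count_degrees_top` and `sum_weightCount`. The first two
rest on a hands-on computation of `Tor(A, R/(X₀, …, X_l))`, adding one variable at a time. -/

namespace NumSemi

open MvPolynomial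

/-! ### Ideals generated by initial segments of the variables -/

section VarIdeal

variable {k : Type*} [Field k] {m : ℕ}

/-- The ideal generated by the first `l` variables. -/
noncomputable def varIdeal (k : Type*) [Field k] (m l : ℕ) : Ideal (MvPolynomial (Fin m) k) :=
  Ideal.span (X '' {i : Fin m | (i : ℕ) < l})

theorem mem_varIdeal {l : ℕ} {f : MvPolynomial (Fin m) k} :
    f ∈ varIdeal k m l ↔ ∀ u, coeff u f ≠ 0 → ∃ i : Fin m, (i : ℕ) < l ∧ u i ≠ 0 := by
  simp [varIdeal, mem_ideal_span_X_image]

theorem mem_varIdeal_zero {f : MvPolynomial (Fin m) k} : f ∈ varIdeal k m 0 ↔ f = 0 := by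
  simp [varIdeal]

theorem varIdeal_mono {l l' : ℕ} (h : l ≤ l') : varIdeal k m l ≤ varIdeal k m l' :=
  Ideal.span_mono (Set.image_mono fun _ hi => lt_of_lt_of_le hi h)

theorem X_mem_varIdeal {i : Fin m} {l : ℕ} (h : (i : ℕ) < l) :
    (X i : MvPolynomial (Fin m) k) ∈ varIdeal k m l :=
  Ideal.subset_span ⟨i, h, rfl⟩

/-- The variables form a regular sequence; for monomial ideals this is visible on supports. -/
theorem mem_varIdeal_of_X_mul_mem {i : Fin m} {f : MvPolynomial (Fin m) k}
    (h : X i * f ∈ varIdeal k m i) : f ∈ varIdeal k m i := by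
  rw [mem_varIdeal] at h ⊢
  intro u hu
  obtain ⟨j, hj, hj'⟩ := h (Finsupp.single i 1 + u) (by rwa [coeff_X_mul])
  refine ⟨j, hj, ?_⟩
  have hij : i ≠ j := by rintro rfl; exact lt_irrefl _ hj
  simpa [Finsupp.single_apply, hij] using hj'

theorem sub_X_mul_divMonomial_mem {i : Fin m} {f : MvPolynomial (Fin m) k}
    (h : f ∈ varIdeal k m (i + 1)) :
    f - X i * f.divMonomial (Finsupp.single i 1) ∈ varIdeal k m i := by
  have e : f - X i * f.divMonomial (Finsupp.single i 1) = f.modMonomial (Finsupp.single i 1) :=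
    sub_eq_of_eq_add' (divMonomial_add_modMonomial_single f i).symm
  rw [e]
  rw [mem_varIdeal] at h ⊢
  intro u hu
  by_cases hle : Finsupp.single i 1 ≤ u
  · exact absurd (coeff_modMonomial_of_le f hle) hu
  · rw [coeff_modMonomial_of_not_le f hle] at hu
    obtain ⟨j, hj, hj'⟩ := h u hu
    refine ⟨j, lt_of_le_of_ne (Nat.lt_succ_iff.1 hj) ?_, hj'⟩
    rintro hji
    obtain rfl : j = i := Fin.ext hji
    exact hle (by simpa [Finsupp.single_le_iff, Nat.one_le_iff_ne_zero] using hj')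

theorem constantCoeff_eq_zero_of_mem_varIdeal {l : ℕ} {f : MvPolynomial (Fin m) k}
    (h : f ∈ varIdeal k m l) : constantCoeff f = 0 := by
  by_contra hf
  obtain ⟨i, -, hi⟩ := mem_varIdeal.1 h 0 hf
  exact hi rfl

theorem mem_varIdeal_of_constantCoeff {f : MvPolynomial (Fin m) k}
    (h : constantCoeff f = 0) : f ∈ varIdeal k m m := by
  rw [mem_varIdeal]
  intro u hu
  by_contra! hc
  obtain rfl : u = 0 := by ext i; exact hc i i.2
  exact hu h

/-- The vectors whose coordinates lie in `varIdeal k m l`. -/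
noncomputable def varSub (k : Type*) [Field k] (m l b : ℕ) :
    Submodule (MvPolynomial (Fin m) k) (Fin b → MvPolynomial (Fin m) k) :=
  Submodule.pi Set.univ fun _ => varIdeal k m l

variable {l b b' : ℕ}

theorem mem_varSub {x : Fin b → MvPolynomial (Fin m) k} :
    x ∈ varSub k m l b ↔ ∀ j, x j ∈ varIdeal k m l := by
  simp [varSub]

theorem mem_varSub_zero {x : Fin b → MvPolynomial (Fin m) k} :
    x ∈ varSub k m 0 b ↔ x = 0 := by
  simp [mem_varSub, mem_varIdeal_zero, funext_iff]

theorem varSub_mono {l' : ℕ} (h : l ≤ l') : varSub k m l b ≤ varSub k m l' b :=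
  fun _ hx => mem_varSub.2 fun j => varIdeal_mono h (mem_varSub.1 hx j)

theorem X_smul_mem_varSub {i : Fin m} (h : (i : ℕ) < l) (x : Fin b → MvPolynomial (Fin m) k) :
    (X i : MvPolynomial (Fin m) k) • x ∈ varSub k m l b :=
  mem_varSub.2 fun _ => Ideal.mul_mem_right _ _ (X_mem_varIdeal h)

theorem mem_varSub_of_X_smul_mem {i : Fin m} {x : Fin b → MvPolynomial (Fin m) k}
    (h : (X i : MvPolynomial (Fin m) k) • x ∈ varSub k m i b) : x ∈ varSub k m i b :=
  mem_varSub.2 fun j => mem_varIdeal_of_X_mul_mem (mem_varSub.1 h j)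

/-- The coordinatewise quotient of the division by `X i`. -/
noncomputable def divX (i : Fin m) (x : Fin b → MvPolynomial (Fin m) k) :
    Fin b → MvPolynomial (Fin m) k :=
  fun j => (x j).divMonomial (Finsupp.single i 1)

theorem sub_X_smul_divX_mem {i : Fin m} {x : Fin b → MvPolynomial (Fin m) k}
    (h : x ∈ varSub k m (i + 1) b) :
    x - (X i : MvPolynomial (Fin m) k) • divX i x ∈ varSub k m i b :=
  mem_varSub.2 fun j => sub_X_mul_divMonomial_mem (mem_varSub.1 h j)

theorem linearMap_apply_eq_sum (f : (Fin b → MvPolynomial (Fin m) k) →ₗ[MvPolynomial (Fin m) k]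
    (Fin b' → MvPolynomial (Fin m) k)) (x : Fin b → MvPolynomial (Fin m) k) (l : Fin b') :
    f x l = ∑ j, x j * f (Pi.single j 1) l := by
  conv_lhs => rw [pi_eq_sum_univ' x]
  simp [map_sum, Finset.sum_apply]

theorem map_mem_varSub (f : (Fin b → MvPolynomial (Fin m) k) →ₗ[MvPolynomial (Fin m) k]
    (Fin b' → MvPolynomial (Fin m) k)) {x : Fin b → MvPolynomial (Fin m) k}
    (hx : x ∈ varSub k m l b) : f x ∈ varSub k m l b' := by
  rw [mem_varSub] at hx ⊢
  intro j
  rw [linearMap_apply_eq_sum]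
  exact Ideal.sum_mem _ fun i _ => Ideal.mul_mem_right _ _ (hx i)

end VarIdeal

/-! ### Monomials and the semigroup ring -/

section MonomialMap

variable {k : Type*} [Field k] {m : ℕ} {d : Fin m → ℕ}

theorem IsMinimalSystem.ne_zero (hd : IsMinimalSystem d) (i : Fin m) : d i ≠ 0 := by
  intro h
  apply hd.minimal i
  rw [h]
  exact zero_mem _

theorem mem_semigroup (i : Fin m) : d i ∈ semigroup d :=
  AddSubmonoid.subset_closure ⟨i, rfl⟩

theorem weight_mem_semigroup (u : Fin m →₀ ℕ) : Finsupp.weight d u ∈ semigroup d := by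
  rw [Finsupp.weight_eq_sum]
  exact sum_mem fun i _ => nsmul_mem (mem_semigroup i) _

theorem exists_weight_eq {s : ℕ} (hs : s ∈ semigroup d) :
    ∃ u : Fin m →₀ ℕ, Finsupp.weight d u = s := by
  induction hs using AddSubmonoid.closure_induction with
  | mem x hx =>
    obtain ⟨i, rfl⟩ := hx
    exact ⟨Finsupp.single i 1, by simp [Finsupp.weight_single]⟩
  | zero => exact ⟨0, by simp⟩
  | add x y _ _ hx hy =>
    obtain ⟨u, rfl⟩ := hx
    obtain ⟨v, rfl⟩ := hy
    exact ⟨u + v, by simp⟩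

theorem monomialMap_monomial (u : Fin m →₀ ℕ) (a : k) :
    monomialMap k d (monomial u a) = Polynomial.monomial (Finsupp.weight d u) a := by
  change aeval _ _ = _
  rw [aeval_monomial, Finsupp.prod_fintype _ _ (by simp), Finsupp.weight_eq_sum]
  simp_rw [← pow_mul, Finset.prod_pow_eq_pow_sum, smul_eq_mul, mul_comm (d _)]
  rw [← Polynomial.C_mul_X_pow_eq_monomial]
  rfl

theorem monomialMap_X (i : Fin m) : monomialMap k d (X i) = Polynomial.X ^ d i := by
  rw [X, monomialMap_monomial, ← Polynomial.X_pow_eq_monomial]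
  simp [Finsupp.weight_single]

theorem monomialMap_C (a : k) : monomialMap k d (C a) = Polynomial.C a := by
  rw [← monomial_zero', monomialMap_monomial]; simp

theorem coeff_monomialMap_ne_zero {p : MvPolynomial (Fin m) k} {n : ℕ}
    (h : (monomialMap k d p).coeff n ≠ 0) :
    ∃ u, coeff u p ≠ 0 ∧ Finsupp.weight d u = n := by
  rw [← support_sum_monomial_coeff p, map_sum, Polynomial.finsetSum_coeff] at h
  obtain ⟨u, hu, hu'⟩ := Finset.exists_ne_zero_of_sum_ne_zero h
  rw [monomialMap_monomial, Polynomial.coeff_monomial] at hu'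
  exact ⟨u, by simpa using hu, by by_contra hc; simp [hc] at hu'⟩

theorem mem_semigroup_of_mem_range {p : Polynomial k} (hp : p ∈ Set.range (monomialMap k d))
    {n : ℕ} (h : p.coeff n ≠ 0) : n ∈ semigroup d := by
  obtain ⟨q, rfl⟩ := hp
  obtain ⟨u, -, rfl⟩ := coeff_monomialMap_ne_zero h
  exact weight_mem_semigroup u

theorem monomial_mem_range {s : ℕ} (hs : s ∈ semigroup d) (a : k) :
    Polynomial.monomial s a ∈ Set.range (monomialMap k d) := by
  obtain ⟨u, rfl⟩ := exists_weight_eq hs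
  exact ⟨monomial u a, monomialMap_monomial u a⟩

end MonomialMap

end NumSemi

/-! ### Vanishing of Tor, graded pieces, and connecting homomorphisms -/

namespace NumSemi

open MvPolynomial

namespace MinimalResolution

variable {k : Type*} [Field k] {m : ℕ} {d : Fin m → ℕ} (R : MinimalResolution k d)

/-- The free module `Fᵢ`. -/
abbrev Free (i : ℕ) : Type _ := Fin (R.betti i) → MvPolynomial (Fin m) k

theorem diff_diff (i : ℕ) (x : R.Free (i + 1 + 1)) : R.diff i (R.diff (i + 1) x) = 0 :=
  (R.exact_succ i _).2 ⟨x, rfl⟩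

theorem aug_diff (x : R.Free 1) : R.aug (R.diff 0 x) = 0 :=
  (R.exact_zero _).2 ⟨x, rfl⟩

theorem exists_diff_eq {i : ℕ} {x : R.Free (i + 1)} (h : R.diff i x = 0) :
    ∃ w, R.diff (i + 1) w = x :=
  (R.exact_succ i x).1 h

theorem exists_diff_zero_eq {x : R.Free 0} (h : R.aug x = 0) : ∃ w, R.diff 0 w = x :=
  (R.exact_zero x).1 h

theorem aug_X_smul (i : Fin m) (x : R.Free 0) :
    R.aug ((X i : MvPolynomial (Fin m) k) • x) = Polynomial.X ^ d i * R.aug x := by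
  rw [map_smulₛₗ, monomialMap_X, smul_eq_mul]

theorem diff_mem_varSub (i : ℕ) (x : R.Free (i + 1)) : R.diff i x ∈ varSub k m m _ := by
  rw [mem_varSub]
  intro j
  rw [linearMap_apply_eq_sum]
  exact Ideal.sum_mem _ fun l _ =>
    Ideal.mul_mem_left _ _ (mem_varIdeal_of_constantCoeff (R.minimal i l j))

/-- This is `Tor_{i+1}(A, R/(X₀, …, X_{l-1})) = 0` for `l ≤ i + 1`, one step better than the length
of the Koszul complex because `X₀` is a nonzerodivisor on `A`. Induction on `l` runs through the
long exact sequence of multiplication by the next variable: `∂x = X_l y` modulo the earlier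
variables, `y` is a boundary there, and correcting `x` by a multiple of `X_l` gives a cycle for the
smaller ideal. -/
theorem exists_sub_diff_mem {l : ℕ} (hl : l ≤ m) {i : ℕ} (hi : l ≤ i + 1) {x : R.Free (i + 1)}
    (hx : R.diff i x ∈ varSub k m l _) : ∃ w, x - R.diff (i + 1) w ∈ varSub k m l _ := by
  induction l generalizing i with
  | zero =>
    obtain ⟨w, rfl⟩ := R.exists_diff_eq (mem_varSub_zero.1 hx)
    exact ⟨w, by simp⟩
  | succ l ih =>
    let v : Fin m := ⟨l, hl⟩
    have key : ∃ w, R.diff i x - (X v : MvPolynomial (Fin m) k) • R.diff i w ∈ varSub k m l _ := by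
      let y := divX v (R.diff i x)
      have hxy : R.diff i x - (X v : MvPolynomial (Fin m) k) • y ∈ varSub k m l _ :=
        sub_X_smul_divX_mem (i := v) hx
      clear_value y
      cases i with
      -- Here `l = 0` is forced, and vanishing of `Tor₁` is injectivity of multiplication by `z ^
      -- d₀` on `k[z]`.
      | zero =>
        obtain rfl : l = 0 := by omega
        have h0 := sub_eq_zero.1 (mem_varSub_zero.1 hxy)
        have h1 : R.aug y = 0 := by
          have h2 := R.aug_diff x
          rw [h0, aug_X_smul] at h2
          exact (mul_eq_zero.1 h2).resolve_left (pow_ne_zero _ Polynomial.X_ne_zero)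
        obtain ⟨w, hw⟩ := R.exists_diff_zero_eq h1
        exact ⟨w, by rwa [hw]⟩
      | succ i =>
        have h1 : R.diff i y ∈ varSub k m l _ := by
          refine mem_varSub_of_X_smul_mem (i := v) ?_
          have h2 := map_mem_varSub (R.diff i) hxy
          rw [map_sub, diff_diff, zero_sub, Submodule.neg_mem_iff, map_smul] at h2
          exact h2
        obtain ⟨w, hw⟩ := ih (by omega) (by omega) h1
        refine ⟨w, ?_⟩
        have := add_mem hxy (Submodule.smul_mem _ (X v : MvPolynomial (Fin m) k) hw)
        rwa [smul_sub, sub_add_sub_cancel] at this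
    obtain ⟨w, hw⟩ := key
    have h1 : R.diff i (x - (X v : MvPolynomial (Fin m) k) • w) ∈ varSub k m l _ := by
      rwa [map_sub, map_smul]
    obtain ⟨w', hw'⟩ := ih (by omega) (by omega) h1
    refine ⟨w', ?_⟩
    have := add_mem (varSub_mono (Nat.le_succ l) hw')
      (X_smul_mem_varSub (l := l + 1) (i := v) (Nat.lt_succ_self l) w)
    convert this using 1
    abel

theorem single_notMem_varSub {b l : ℕ} (j : Fin b) :
    (Pi.single j 1 : Fin b → MvPolynomial (Fin m) k) ∉ varSub k m l b := fun h => by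
  have := constantCoeff_eq_zero_of_mem_varIdeal (mem_varSub.1 h j)
  simp at this

/-- By minimality a basis vector is a cycle modulo all the variables, so by the Tor vanishing it is
a boundary modulo them; but boundaries are zero modulo them. -/
theorem betti_eq_zero {i : ℕ} (hi : m ≤ i) (hm : 0 < m) : R.betti i = 0 := by
  obtain ⟨i, rfl⟩ : ∃ i', i = i' + 1 := ⟨i - 1, by omega⟩
  by_contra hb
  let j : Fin (R.betti (i + 1)) := ⟨0, Nat.pos_of_ne_zero hb⟩
  obtain ⟨w, hw⟩ := R.exists_sub_diff_mem le_rfl hi (x := Pi.single j 1) (R.diff_mem_varSub _ _)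
  have := add_mem hw (R.diff_mem_varSub _ w)
  rw [sub_add_cancel] at this
  exact single_notMem_varSub j this

/-! ### Degrees -/

/-- Every homogeneous component of `x` has its degree in `T`. -/
def DegIn {i : ℕ} (T : Set ℤ) (x : R.Free i) : Prop :=
  ∀ l u, coeff u (x l) ≠ 0 → (Finsupp.weight d u : ℤ) + R.syzDeg i l ∈ T

variable {R}

theorem DegIn.diff {i : ℕ} {T : Set ℤ} {x : R.Free (i + 1)} (h : R.DegIn T x) :
    R.DegIn T (R.diff i x) := by
  classical
  intro l u hu
  rw [linearMap_apply_eq_sum, coeff_sum] at hu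
  obtain ⟨j, -, hj⟩ := Finset.exists_ne_zero_of_sum_ne_zero hu
  rw [coeff_mul] at hj
  obtain ⟨⟨u₁, u₂⟩, hu, hj⟩ := Finset.exists_ne_zero_of_sum_ne_zero hj
  have h1 := h j u₁ (left_ne_zero_of_mul hj)
  have h2 := R.diff_homogeneous i j l u₂ (right_ne_zero_of_mul hj)
  rw [Finset.HasAntidiagonal.mem_antidiagonal] at hu
  rw [← hu, map_add]
  convert h1 using 1
  rw [← h2]
  push_cast
  ring

theorem aug_apply_eq_sum (x : R.Free 0) :
    R.aug x = ∑ j, monomialMap k d (x j) * R.aug (Pi.single j 1) := by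
  conv_lhs => rw [pi_eq_sum_univ' x]
  simp [map_sum]

theorem DegIn.aug {T : Set ℤ} {x : R.Free 0} (h : R.DegIn T x) {n : ℕ}
    (hn : (R.aug x).coeff n ≠ 0) : (n : ℤ) ∈ T := by
  classical
  rw [aug_apply_eq_sum, Polynomial.finsetSum_coeff] at hn
  obtain ⟨j, -, hj⟩ := Finset.exists_ne_zero_of_sum_ne_zero hn
  rw [Polynomial.coeff_mul] at hj
  obtain ⟨⟨n₁, n₂⟩, hn, hj⟩ := Finset.exists_ne_zero_of_sum_ne_zero hj
  obtain ⟨u, hu, rfl⟩ := coeff_monomialMap_ne_zero (left_ne_zero_of_mul hj)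
  have h1 := h j u hu
  have h2 := right_ne_zero_of_mul hj
  obtain ⟨a, ha⟩ := R.aug_homogeneous j
  rw [ha, Polynomial.coeff_monomial] at h2
  rw [Finset.HasAntidiagonal.mem_antidiagonal] at hn
  rw [← hn]
  have : R.syzDeg 0 j = n₂ := by by_contra hc; simp [hc] at h2
  rw [← this]
  exact_mod_cast h1

theorem aug_eq_monomial {y : ℕ} {x : R.Free 0} (h : R.DegIn {(y : ℤ)} x) :
    R.aug x = Polynomial.monomial y ((R.aug x).coeff y) := by
  ext n
  rw [Polynomial.coeff_monomial]
  split_ifs with hn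
  · rw [hn]
  · by_contra hc
    exact hn (by exact_mod_cast (h.aug hc).symm)

theorem degIn_single {i : ℕ} (j : Fin (R.betti i)) :
    R.DegIn {(R.syzDeg i j : ℤ)} (Pi.single j 1 : R.Free i) := by
  classical
  intro l u hu
  by_cases hjl : l = j
  · subst hjl
    rw [Pi.single_eq_same, coeff_one] at hu
    have : 0 = u := by by_contra hc; simp [hc] at hu
    simp [← this]
  · simp [Pi.single_eq_of_ne hjl] at hu

theorem DegIn.divX {i : ℕ} {y : ℤ} {x : R.Free i} (h : R.DegIn {y} x) (v : Fin m) :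
    R.DegIn {y - d v} (divX v x : R.Free i) := by
  intro l u hu
  rw [NumSemi.divX, coeff_divMonomial] at hu
  have := h l _ hu
  simp only [map_add, Finsupp.weight_single, Set.mem_singleton_iff] at this ⊢
  rw [← this]
  simp
  ring

variable (R)

theorem aug_mem_range (x : R.Free 0) : R.aug x ∈ Set.range (monomialMap k d) := by
  rw [← R.range_aug]; exact ⟨x, rfl⟩

theorem exists_aug_eq {p : Polynomial k} (hp : p ∈ Set.range (monomialMap k d)) :
    ∃ x, R.aug x = p := by
  rwa [← R.range_aug] at hp

theorem exists_syzDeg_zero_eq_zero :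
    ∃ j, R.syzDeg 0 j = 0 ∧ ∃ a : k, a ≠ 0 ∧ R.aug (Pi.single j 1) = Polynomial.C a := by
  obtain ⟨x, hx⟩ := R.exists_aug_eq (p := 1) ⟨1, map_one _⟩
  have h0 : (R.aug x).coeff 0 ≠ 0 := by simp [hx]
  rw [aug_apply_eq_sum, Polynomial.finsetSum_coeff] at h0
  obtain ⟨j, -, hj⟩ := Finset.exists_ne_zero_of_sum_ne_zero h0
  rw [Polynomial.mul_coeff_zero] at hj
  obtain ⟨a, ha⟩ := R.aug_homogeneous j
  have h2 := right_ne_zero_of_mul hj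
  rw [ha, Polynomial.coeff_monomial] at h2
  have hC : R.syzDeg 0 j = 0 := by by_contra hc; simp [hc] at h2
  refine ⟨j, hC, a, ?_, ?_⟩
  · rintro rfl; simp at h2
  · rw [ha, hC, Polynomial.monomial_zero_left]

/-- Some generator maps to a nonzero constant, which generates `A`. Any further generator would
differ from a multiple of it by a boundary with a unit coordinate, against minimality. -/
theorem degrees_zero : R.degrees 0 = {0} := by
  obtain ⟨j, hj, a, ha, haug⟩ := R.exists_syzDeg_zero_eq_zero
  have huniq : ∀ i, i = j := by
    intro i
    by_contra hij
    obtain ⟨p, hp⟩ := R.aug_mem_range (Pi.single i 1)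
    have h0 : R.aug (Pi.single i 1 - (C a⁻¹ * p) • (Pi.single j 1 : R.Free 0)) = 0 := by
      rw [map_sub, map_smulₛₗ, haug, map_mul, monomialMap_C, hp, smul_eq_mul, mul_right_comm,
        ← Polynomial.C_mul, inv_mul_cancel₀ ha]
      simp
    obtain ⟨w, hw⟩ := R.exists_diff_zero_eq h0
    have h1 := mem_varSub.1 (R.diff_mem_varSub 0 w) i
    rw [hw] at h1
    have h2 := constantCoeff_eq_zero_of_mem_varIdeal h1
    simp [Pi.single_eq_of_ne hij] at h2
  have : Finset.univ = {j} := by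
    ext i; simp [huniq i]
  simp [degrees, this, hj]

/-! ### The last syzygies -/

/-- The relation between `F_l` and `F₀` obtained by composing the connecting homomorphisms between
the homology modules of the complexes `F / (X₀, …, X_i) F`. -/
def Chain : (l : ℕ) → R.Free l → R.Free 0 → Prop
  | 0, x', x => x' = x
  | l + 1, x', x => ∃ x'', Chain l x'' x ∧ ∃ h : l + 1 < m,
      R.diff l x' - (X ⟨l + 1, h⟩ : MvPolynomial (Fin m) k) • x'' ∈ varSub k m (l + 1) _

/-- `x` is a cycle of the complex `F / (X₀, …, X_l) F`. -/
def IsCycle : (l : ℕ) → R.Free l → Prop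
  | 0, _ => True
  | l + 1, x => R.diff l x ∈ varSub k m (l + 2) _

variable {R}

theorem Chain.smul {l : ℕ} {x' : R.Free l} {x : R.Free 0} (h : R.Chain l x' x)
    (p : MvPolynomial (Fin m) k) : R.Chain l (p • x') (p • x) := by
  induction l with
  | zero => exact congrArg (p • ·) h
  | succ l ih =>
    obtain ⟨x'', h1, hl, h2⟩ := h
    refine ⟨p • x'', ih h1, hl, ?_⟩
    rw [map_smul, smul_comm _ p, ← smul_sub]
    exact Submodule.smul_mem _ _ h2

theorem Chain.add {l : ℕ} {x' y' : R.Free l} {x y : R.Free 0} (h : R.Chain l x' x)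
    (h' : R.Chain l y' y) : R.Chain l (x' + y') (x + y) := by
  induction l with
  | zero => exact congrArg₂ (· + ·) h h'
  | succ l ih =>
    obtain ⟨x'', h1, hl, h2⟩ := h
    obtain ⟨y'', h1', hl', h2'⟩ := h'
    refine ⟨x'' + y'', ih h1 h1', hl, ?_⟩
    rw [map_add, smul_add, add_sub_add_comm]
    exact add_mem h2 h2'

theorem chain_zero {l : ℕ} (hl : l < m) : R.Chain l 0 0 := by
  induction l with
  | zero => rfl
  | succ l ih => exact ⟨0, ih (by omega), hl, by simp⟩

theorem chain_sum {l : ℕ} (hl : l < m) {ι : Type*} (s : Finset ι) {f : ι → R.Free l}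
    {g : ι → R.Free 0} (h : ∀ i, R.Chain l (f i) (g i)) :
    R.Chain l (∑ i ∈ s, f i) (∑ i ∈ s, g i) := by
  classical
  induction s using Finset.induction_on with
  | empty => simpa using chain_zero hl
  | insert i s hi ih =>
    rw [Finset.sum_insert hi, Finset.sum_insert hi]
    exact (h i).add ih

variable (R) in
/-- The augmentation of `x` vanishes modulo `X₀`. -/
def AugZero (hm : 0 < m) (x : R.Free 0) : Prop :=
  ∃ w, R.aug x = R.aug ((X ⟨0, hm⟩ : MvPolynomial (Fin m) k) • w)

/-- Injectivity of `Tor_l(A, R/(X₀, …, X_l)) → A/X₀A`: the kernel of each connecting map comes from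
a Tor group that vanishes. -/
theorem Chain.exists_sub_diff_mem {l : ℕ} {x' : R.Free l} {x : R.Free 0} (h : R.Chain l x' x)
    (hm : 0 < m) (hx : R.AugZero hm x) :
    ∃ w, x' - R.diff l w ∈ varSub k m (l + 1) _ := by
  induction l with
  | zero =>
    obtain rfl : x' = x := h
    obtain ⟨w, hw⟩ := hx
    obtain ⟨v, hv⟩ := R.exists_diff_zero_eq
      (x := x' - (X ⟨0, hm⟩ : MvPolynomial (Fin m) k) • w) (by rw [map_sub, hw, sub_self])
    refine ⟨v, ?_⟩
    rw [hv, sub_sub_cancel]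
    exact X_smul_mem_varSub (by simp) w
  | succ l ih =>
    obtain ⟨x'', h1, hl, h2⟩ := h
    obtain ⟨w, hw⟩ := ih h1
    have h3 : R.diff l (x' - (X ⟨l + 1, hl⟩ : MvPolynomial (Fin m) k) • w) ∈
        varSub k m (l + 1) _ := by
      have := add_mem h2 (Submodule.smul_mem _ (X ⟨l + 1, hl⟩ : MvPolynomial (Fin m) k) hw)
      rwa [smul_sub, sub_add_sub_cancel, ← map_smul, ← map_sub] at this
    obtain ⟨v, hv⟩ := R.exists_sub_diff_mem hl.le le_rfl h3
    refine ⟨v, ?_⟩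
    have := add_mem (varSub_mono (Nat.le_succ (l + 1)) hv)
      (X_smul_mem_varSub (l := l + 2) (i := ⟨l + 1, hl⟩) (Nat.lt_succ_self (l + 1)) w)
    convert this using 1
    abel

/-- Well-definedness of the same map: boundaries go to zero. -/
theorem Chain.augZero {l : ℕ} {x' : R.Free l} {x : R.Free 0} (h : R.Chain l x' x)
    (hm : 0 < m) {w : R.Free (l + 1)} (hw : x' - R.diff l w ∈ varSub k m (l + 1) _) :
    R.AugZero hm x := by
  induction l with
  | zero =>
    obtain rfl : x' = x := h
    refine ⟨divX ⟨0, hm⟩ (x' - R.diff 0 w), ?_⟩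
    have h1 := mem_varSub_zero.1 (sub_X_smul_divX_mem (i := ⟨0, hm⟩) hw)
    rw [← sub_eq_zero.1 h1, map_sub, aug_diff, sub_zero]
  | succ l ih =>
    obtain ⟨x'', h1, hl, h2⟩ := h
    set v : Fin m := ⟨l + 1, hl⟩
    set c := divX v (x' - R.diff (l + 1) w)
    have h3 := map_mem_varSub (R.diff l) (sub_X_smul_divX_mem (i := v) hw)
    refine ih h1 (w := c) ?_
    apply mem_varSub_of_X_smul_mem (i := v)
    have h4 := sub_mem h3 h2
    rw [map_sub, map_sub, diff_diff, sub_zero, sub_sub_sub_cancel_left, map_smul, ← smul_sub] at h4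
    exact h4

/-- The image of each connecting map is killed by the variable being added. For `l = m - 1` the
composite therefore lands in the socle of `A/X₀A`; `exists_chain_of_augZero` shows that the whole
socle is reached. -/
theorem Chain.augZero_X_smul {l : ℕ} {x' : R.Free l} {x : R.Free 0} (h : R.Chain l x' x)
    (hm : 0 < m) {i : Fin m} (hi : (i : ℕ) ≤ l) :
    R.AugZero hm ((X i : MvPolynomial (Fin m) k) • x) := by
  induction l with
  | zero =>
    obtain rfl : i = ⟨0, hm⟩ := Fin.ext (Nat.le_zero.1 hi)
    exact ⟨x, rfl⟩
  | succ l ih =>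
    obtain ⟨x'', h1, hl, h2⟩ := h
    rcases Nat.lt_or_ge (i : ℕ) (l + 1) with hi' | hi'
    · exact ih h1 (Nat.lt_succ_iff.1 hi')
    · obtain rfl : i = ⟨l + 1, hl⟩ := Fin.ext (le_antisymm hi hi')
      refine (h1.smul _).augZero hm (w := x') ?_
      rw [← neg_sub]
      exact Submodule.neg_mem _ h2

theorem exists_chain_of_augZero {l : ℕ} (hl : l < m) (hm : 0 < m) {x : R.Free 0}
    (hx : ∀ i : Fin m, R.AugZero hm ((X i : MvPolynomial (Fin m) k) • x)) :
    ∃ x', R.Chain l x' x := by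
  induction l with
  | zero => exact ⟨x, rfl⟩
  | succ l ih =>
    obtain ⟨x'', h⟩ := ih (by omega)
    obtain ⟨w, hw⟩ := (h.smul (X ⟨l + 1, hl⟩)).exists_sub_diff_mem hm (hx _)
    refine ⟨w, x'', h, hl, ?_⟩
    rw [← neg_sub]
    exact Submodule.neg_mem _ hw

variable (d) in
/-- The sum `d₁ + … + d_l`, where the indices start at `0`. -/
def tailSum (l : ℕ) : ℤ :=
  ∑ i ∈ Finset.range l, if h : i + 1 < m then (d ⟨i + 1, h⟩ : ℤ) else 0

theorem tailSum_eq {l : ℕ} (hl : l + 1 = m) (hm : 0 < m) :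
    tailSum d l = genSum d - d ⟨0, hm⟩ := by
  subst hl
  rw [genSum, Fin.sum_univ_succ, tailSum, Finset.sum_range]
  simp
  rfl

theorem isCycle_of_sub_X_smul_mem {l : ℕ} {hl : l + 1 < m} {z : R.Free (l + 1)} {y : R.Free l}
    (h : R.diff l z - (X ⟨l + 1, hl⟩ : MvPolynomial (Fin m) k) • y ∈ varSub k m (l + 1) _) :
    R.IsCycle l y := by
  cases l with
  | zero => trivial
  | succ l =>
    apply mem_varSub_of_X_smul_mem (i := ⟨l + 2, hl⟩)
    have h2 := map_mem_varSub (R.diff l) h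
    rw [map_sub, diff_diff, zero_sub, Submodule.neg_mem_iff, map_smul] at h2
    exact h2

/-- Each connecting map divides by one variable, so the degree drops by the corresponding generator.
-/
theorem exists_chain {l : ℕ} (hl : l < m) {y : ℤ} {x' : R.Free l} (hx : R.IsCycle l x')
    (hy : R.DegIn {y} x') : ∃ x, R.Chain l x' x ∧ R.DegIn {y - tailSum d l} x := by
  induction l generalizing y with
  | zero => exact ⟨x', rfl, by simpa [tailSum] using hy⟩
  | succ l ih =>
    set v : Fin m := ⟨l + 1, hl⟩ with hv
    have h1 := sub_X_smul_divX_mem (i := v) hx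
    set x'' := divX v (R.diff l x')
    obtain ⟨x, h3, h4⟩ := ih (by omega) (isCycle_of_sub_X_smul_mem (hl := hl) h1) (hy.diff.divX v)
    refine ⟨x, ⟨x'', h3, hl, h1⟩, ?_⟩
    convert h4 using 2
    rw [tailSum, Finset.sum_range_succ, dif_pos hl, tailSum]
    ring

theorem isCycle_top {l : ℕ} (hl : l + 1 = m) (x : R.Free l) : R.IsCycle l x := by
  match l with
  | 0 => trivial
  | l + 1 =>
    have := R.diff_mem_varSub l x
    subst hl
    exact this

end MinimalResolution

end NumSemi

/-! ### Last syzygies and pseudo-Frobenius numbers -/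

namespace NumSemi

open MvPolynomial

theorem exists_eq_add_of_mem_semigroup {m : ℕ} {d : Fin m → ℕ} {s : ℕ} (hs : s ∈ semigroup d)
    (h0 : s ≠ 0) : ∃ i, ∃ t ∈ semigroup d, s = d i + t := by
  obtain ⟨u, rfl⟩ := exists_weight_eq hs
  obtain ⟨i, hi⟩ : ∃ i, u i ≠ 0 := by
    by_contra! hc
    obtain rfl : u = 0 := Finsupp.ext hc
    simp at h0
  exact ⟨i, _, weight_mem_semigroup (u - Finsupp.single i 1), by
    rw [add_comm, Finsupp.weight_sub_single_add hi]⟩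

namespace MinimalResolution

variable {k : Type*} [Field k] {m : ℕ} {d : Fin m → ℕ} {R : MinimalResolution k d}

theorem augZero_iff_of_aug_eq_monomial {hm : 0 < m} {x : R.Free 0} {n : ℕ} {a : k} (ha : a ≠ 0)
    (hx : R.aug x = Polynomial.monomial n a) :
    R.AugZero hm x ↔ ∃ s ∈ semigroup d, d ⟨0, hm⟩ + s = n := by
  constructor
  · rintro ⟨w, hw⟩
    rw [hx, aug_X_smul] at hw
    have h1 := congrArg (fun p => Polynomial.coeff p n) hw
    simp only [Polynomial.coeff_monomial_same, Polynomial.coeff_X_pow_mul'] at h1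
    split_ifs at h1 with h2
    · exact ⟨n - d ⟨0, hm⟩, mem_semigroup_of_mem_range (R.aug_mem_range w) (h1 ▸ ha), by omega⟩
    · exact absurd h1 ha
  · rintro ⟨s, hs, rfl⟩
    obtain ⟨w, hw⟩ := R.exists_aug_eq (monomial_mem_range hs a)
    refine ⟨w, ?_⟩
    rw [hx, aug_X_smul, hw, Polynomial.X_pow_mul_monomial, add_comm]

theorem Chain.mem_varSub {l : ℕ} (hl : l + 1 = m) {x' : R.Free l} {x : R.Free 0}
    (h : R.Chain l x' x) (hm : 0 < m) (hx : R.AugZero hm x) : x' ∈ varSub k m m _ := by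
  obtain ⟨w, hw⟩ := h.exists_sub_diff_mem hm hx
  have := add_mem (varSub_mono hl.le hw) (R.diff_mem_varSub l w)
  rwa [sub_add_cancel] at this

theorem exists_chain_single {l : ℕ} (hl : l + 1 = m) (hm : 0 < m) (j : Fin (R.betti l)) :
    ∃ x : R.Free 0, R.Chain l (Pi.single j 1) x ∧ ¬ R.AugZero hm x ∧
      ∃ (n : ℕ) (a : k), a ≠ 0 ∧ R.aug x = Polynomial.monomial n a ∧
        (R.syzDeg l j : ℤ) = n + (genSum d - d ⟨0, hm⟩) := by
  obtain ⟨x, h1, h2⟩ := exists_chain (by omega) (isCycle_top hl _) (degIn_single j)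
  have h3 : ¬ R.AugZero hm x := fun h => single_notMem_varSub j (h1.mem_varSub hl hm h)
  have h4 : R.aug x ≠ 0 := fun h => h3 ⟨0, by rw [h, smul_zero, map_zero]⟩
  obtain ⟨n, hn⟩ : ∃ n, (R.aug x).coeff n ≠ 0 := by
    by_contra! hc
    exact h4 (Polynomial.ext hc)
  have h5 := h2.aug hn
  rw [Set.mem_singleton_iff, tailSum_eq hl hm] at h5
  rw [tailSum_eq hl hm, ← h5] at h2
  exact ⟨x, h1, h3, n, _, hn, aug_eq_monomial h2, by rw [h5]; ring⟩

/-- A monomial `z ^ n` is a nonzero socle element of `A/z ^ d₀ A` exactly when `n - d₀` is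
pseudo-Frobenius. -/
theorem Chain.sub_mem_pseudoFrobenius {l : ℕ} (hl : l + 1 = m) {hm : 0 < m} {x' : R.Free l}
    {x : R.Free 0} (h : R.Chain l x' x) (hx : ¬ R.AugZero hm x) {n : ℕ} {a : k} (ha : a ≠ 0)
    (hxn : R.aug x = Polynomial.monomial n a) :
    (n : ℤ) - d ⟨0, hm⟩ ∈ pseudoFrobenius d := by
  rw [augZero_iff_of_aug_eq_monomial ha hxn] at hx
  refine ⟨fun ⟨s, hs, hs'⟩ => hx ⟨s, hs, by omega⟩, fun s hs h0 => ?_⟩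
  obtain ⟨i, t, ht, rfl⟩ := exists_eq_add_of_mem_semigroup hs h0
  have h1 := h.augZero_X_smul hm (i := i) (by omega)
  rw [augZero_iff_of_aug_eq_monomial (n := n + d i) ha] at h1
  · obtain ⟨r, hr, hr'⟩ := h1
    exact ⟨r + t, add_mem hr ht, by push_cast; omega⟩
  · rw [aug_X_smul, hxn, Polynomial.X_pow_mul_monomial]

/-- Graded pieces of `A` are at most one-dimensional, so two basis vectors of equal degree have
proportional socle images. By injectivity a nontrivial constant combination of them would vanish
modulo the variables. -/
theorem syzDeg_top_injective {l : ℕ} (hl : l + 1 = m) : Function.Injective (R.syzDeg l) := by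
  have hm : 0 < m := by omega
  intro i j hij
  by_contra hne
  obtain ⟨x, hx, -, n, a, ha, hxn, h1⟩ := exists_chain_single hl hm i
  obtain ⟨y, hy, -, n', b, hb, hyn, h2⟩ := exists_chain_single hl hm j
  obtain rfl : n = n' := by rw [hij] at h1; omega
  have h3 := ((hx.smul (C b)).add (hy.smul (C (-a)))).mem_varSub hl hm
    ⟨0, by
      rw [map_add, map_smulₛₗ, map_smulₛₗ, hxn, hyn, monomialMap_C, monomialMap_C]
      simp [Polynomial.C_mul_monomial, mul_comm]⟩
  have h4 := constantCoeff_eq_zero_of_mem_varIdeal (NumSemi.mem_varSub.1 h3 i)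
  simp [Pi.single_eq_of_ne hne] at h4
  exact hb h4

theorem exists_syzDeg_top_eq (hd : IsMinimalSystem d) {l : ℕ} (hl : l + 1 = m) {f : ℤ}
    (hf : f ∈ pseudoFrobenius d) : ∃ j, (R.syzDeg l j : ℤ) = f + genSum d := by
  have hm : 0 < m := by omega
  obtain ⟨hf1, hf2⟩ := hf
  obtain ⟨n, hn, hn'⟩ := hf2 _ (mem_semigroup ⟨0, hm⟩) (hd.ne_zero _)
  obtain ⟨x, hx⟩ := R.exists_aug_eq (monomial_mem_range hn 1)
  obtain ⟨x', hx'⟩ := exists_chain_of_augZero (l := l) (by omega) hm (x := x) fun i => by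
    rw [augZero_iff_of_aug_eq_monomial (n := n + d i) one_ne_zero]
    · obtain ⟨s, hs, hs'⟩ := hf2 _ (mem_semigroup i) (hd.ne_zero _)
      exact ⟨s, hs, by omega⟩
    · rw [aug_X_smul, hx, Polynomial.X_pow_mul_monomial]
  choose g hg hg' N a ha hgN hN using exists_chain_single (R := R) hl hm
  -- Expanding `x'` in the basis relates `0` to `∑ x'ⱼ gⱼ - x`, so `z ^ n` is congruent to the image
  -- of `∑ x'ⱼ gⱼ` modulo `z ^ d₀ A`.
  have h1 := (chain_sum (by omega) Finset.univ fun j => (hg j).smul (x' j)).add (hx'.smul (-1))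
  rw [show ∑ j, x' j • (Pi.single j 1 : R.Free l) = x' by rw [← pi_eq_sum_univ' x'], neg_one_smul,
    add_neg_cancel] at h1
  obtain ⟨w, hw⟩ := h1.augZero hm (w := 0) (by simp)
  rw [aug_X_smul, map_add, map_sum, map_smulₛₗ, hx] at hw
  have h2 := congrArg (fun p => Polynomial.coeff p n) hw
  have h3 : (Polynomial.X ^ d ⟨0, hm⟩ * R.aug w).coeff n = 0 := by
    rw [Polynomial.coeff_X_pow_mul']
    split_ifs with hle
    · by_contra hc
      exact hf1 ⟨_, mem_semigroup_of_mem_range (R.aug_mem_range w) hc, by omega⟩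
    · rfl
  simp only [h3, map_neg, map_one, Polynomial.coeff_add, neg_smul, one_smul, Polynomial.coeff_neg,
    Polynomial.coeff_monomial_same, Polynomial.finsetSum_coeff] at h2
  obtain ⟨j, -, hj⟩ := Finset.exists_ne_zero_of_sum_ne_zero
    (show _ ≠ (0 : k) by rw [add_neg_eq_zero.1 h2]; exact one_ne_zero)
  refine ⟨j, ?_⟩
  rw [map_smulₛₗ, hgN, smul_eq_mul, Polynomial.coeff_mul] at hj
  obtain ⟨⟨n₁, n₂⟩, h4, h5⟩ := Finset.exists_ne_zero_of_sum_ne_zero hj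
  rw [Finset.HasAntidiagonal.mem_antidiagonal] at h4
  obtain ⟨u, -, rfl⟩ := coeff_monomialMap_ne_zero (left_ne_zero_of_mul h5)
  have h6 := right_ne_zero_of_mul h5
  rw [Polynomial.coeff_monomial] at h6
  have h7 : N j = n₂ := by by_contra hc; simp [hc] at h6
  -- A positive weight would put `f`, being the pseudo-Frobenius number `N j - d₀` plus a nonzero
  -- element of `S`, into `S`.
  rcases eq_or_ne (Finsupp.weight d u) 0 with h8 | h8
  · have := hN j
    omega
  · obtain ⟨s, hs, hs'⟩ := ((hg j).sub_mem_pseudoFrobenius hl (hg' j) (ha j) (hgN j)).2 _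
      (weight_mem_semigroup u) h8
    exact absurd ⟨s, hs, by omega⟩ hf1

open Classical in
theorem count_degrees_top (hd : IsMinimalSystem d) {l : ℕ} (hl : l + 1 = m) (y : ℤ) :
    (R.degrees l).count y = if y - genSum d ∈ pseudoFrobenius d then 1 else 0 := by
  have hm : 0 < m := by omega
  have hnd : (R.degrees l).Nodup :=
    Finset.univ.nodup.map fun i j hij => syzDeg_top_injective hl (by exact_mod_cast hij)
  rw [Multiset.count_eq_of_nodup hnd]
  refine if_congr ?_ rfl rfl
  simp only [degrees, Multiset.mem_map, Finset.mem_val, Finset.mem_univ, true_and]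
  constructor
  · rintro ⟨j, rfl⟩
    obtain ⟨x, hx, hx', n, a, ha, hxn, h1⟩ := exists_chain_single hl hm j
    have := hx.sub_mem_pseudoFrobenius hl hx' ha hxn
    convert this using 1
    omega
  · intro h
    obtain ⟨j, hj⟩ := exists_syzDeg_top_eq (R := R) hd hl h
    exact ⟨j, by omega⟩

end MinimalResolution

end NumSemi

/-! ### Hilbert series of the resolution -/

namespace NumSemi

open MvPolynomial

/-- The number of exponents of weighted degree `y`. -/
noncomputable def weightCount {m : ℕ} (d : Fin m → ℕ) (y : ℤ) : ℕ :=
  Nat.card {u : Fin m →₀ ℕ | (Finsupp.weight d u : ℤ) = y}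

theorem finite_weight_eq {m : ℕ} {d : Fin m → ℕ} (hd : ∀ i, d i ≠ 0) (y : ℤ) :
    {u : Fin m →₀ ℕ | (Finsupp.weight d u : ℤ) = y}.Finite :=
  (Finsupp.finite_of_nat_weight_le d hd y.toNat).subset fun u (hu : _ = y) => by
    simp only [Set.mem_ofPred_eq]; omega

/-- The Euler characteristic of a bounded exact sequence of finite-dimensional spaces. -/
theorem sum_neg_one_pow_finrank {k : Type*} [Field k] {V : ℕ → Type*} {W : Type*}
    [∀ i, AddCommGroup (V i)] [∀ i, Module k (V i)] [∀ i, Module.Finite k (V i)]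
    [AddCommGroup W] [Module k W] (f : ∀ i, V (i + 1) →ₗ[k] V i) (g : V 0 →ₗ[k] W)
    (h0 : LinearMap.range (f 0) = LinearMap.ker g)
    (h : ∀ i, LinearMap.range (f (i + 1)) = LinearMap.ker (f i)) {n : ℕ}
    (hn : Subsingleton (V n)) :
    ∑ i ∈ Finset.range n, (-1 : ℤ) ^ i * Module.finrank k (V i) =
      Module.finrank k (LinearMap.range g) := by
  cases n with
  | zero =>
    have : Subsingleton (LinearMap.range g) := by
      rw [Submodule.subsingleton_iff_eq_bot, LinearMap.range_eq_bot]
      exact Subsingleton.elim _ _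
    simp [Module.finrank_zero_of_subsingleton]
  | succ n =>
    have key : ∀ n, ∑ i ∈ Finset.range (n + 1), (-1 : ℤ) ^ i * Module.finrank k (V i) =
        Module.finrank k (LinearMap.range g) +
          (-1) ^ n * Module.finrank k (LinearMap.range (f n)) := by
      intro n
      induction n with
      | zero =>
        have := g.finrank_range_add_finrank_ker
        rw [← h0] at this
        simp [← this]
      | succ n ih =>
        have := (f n).finrank_range_add_finrank_ker
        rw [← h] at this
        rw [Finset.sum_range_succ, ih, ← this]
        push_cast
        ring
    rw [key, add_eq_left]
    have : LinearMap.range (f n) = ⊥ := by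
      rw [LinearMap.range_eq_bot]
      ext x
      rw [Subsingleton.elim x 0, map_zero, map_zero]
    rw [this]
    simp

namespace MinimalResolution

variable {k : Type*} [Field k] {m : ℕ} {d : Fin m → ℕ} (R : MinimalResolution k d)

/-- The homogeneous part of degree `y` of `Fᵢ`. -/
noncomputable def piece (y : ℤ) (i : ℕ) : Submodule k (R.Free i) :=
  Submodule.pi Set.univ fun l =>
    restrictSupport k {u | (Finsupp.weight d u : ℤ) = y - R.syzDeg i l}

variable {R}

theorem mem_piece {y : ℤ} {i : ℕ} {x : R.Free i} : x ∈ R.piece y i ↔ R.DegIn {y} x := by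
  simp only [piece, Submodule.mem_pi, Set.mem_univ, forall_true_left, mem_restrictSupport_iff,
    DegIn, Set.subset_def, Finset.mem_coe, mem_support_iff, Set.mem_ofPred_eq,
    Set.mem_singleton_iff, eq_sub_iff_add_eq]

variable (R)

/-- A homogeneous part is the product of the homogeneous parts of its coordinates. -/
noncomputable def pieceEquiv (y : ℤ) (i : ℕ) : R.piece y i ≃ₗ[k]
    ∀ l, restrictSupport k {u : Fin m →₀ ℕ | (Finsupp.weight d u : ℤ) = y - R.syzDeg i l} where
  toFun x l := ⟨x.1 l, x.2 l trivial⟩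
  invFun x := ⟨fun l => (x l).1, fun l _ => (x l).2⟩
  map_add' _ _ := rfl
  map_smul' _ _ := rfl
  left_inv _ := rfl
  right_inv _ := rfl

variable {R}

theorem finite_restrictSupport (hd : IsMinimalSystem d) (y : ℤ) :
    Module.Finite k (restrictSupport k {u : Fin m →₀ ℕ | (Finsupp.weight d u : ℤ) = y}) :=
  have := (finite_weight_eq hd.ne_zero y).to_subtype
  Module.Finite.of_basis (basisRestrictSupport k _)

theorem finite_piece (hd : IsMinimalSystem d) (y : ℤ) (i : ℕ) : Module.Finite k (R.piece y i) :=
  have := fun y => finite_restrictSupport (k := k) hd y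
  Module.Finite.equiv (R.pieceEquiv y i).symm

theorem finrank_piece (hd : IsMinimalSystem d) (y : ℤ) (i : ℕ) :
    Module.finrank k (R.piece y i) = ∑ l, weightCount d (y - R.syzDeg i l) := by
  have := fun y => finite_restrictSupport (k := k) hd y
  rw [(R.pieceEquiv y i).finrank_eq, Module.finrank_pi_fintype]
  exact Finset.sum_congr rfl fun l _ =>
    Module.finrank_eq_nat_card_basis (basisRestrictSupport k _)

/-- Every element splits into its component of degree `y` and a part without that degree. -/
theorem exists_degIn_compl (y : ℤ) {i : ℕ} (x : R.Free i) :
    ∃ x', R.DegIn {y} x' ∧ R.DegIn {y}ᶜ (x - x') := by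
  classical
  refine ⟨fun l => if (R.syzDeg i l : ℤ) ≤ y then
    weightedHomogeneousComponent d (y - R.syzDeg i l).toNat (x l) else 0, ?_, ?_⟩
  · intro l u hu
    dsimp only at hu
    split_ifs at hu with h
    · rw [coeff_weightedHomogeneousComponent] at hu
      split_ifs at hu with h'
      · rw [Set.mem_singleton_iff]; omega
      · exact absurd rfl hu
    · simp at hu
  · intro l u hu h
    rw [Set.mem_singleton_iff] at h
    apply hu
    rw [Pi.sub_apply, if_pos (by omega), coeff_sub, coeff_weightedHomogeneousComponent,
      if_pos (by omega), sub_self]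

theorem DegIn.sub {T : Set ℤ} {i : ℕ} {x y : R.Free i} (hx : R.DegIn T x) (hy : R.DegIn T y) :
    R.DegIn T (x - y) := by
  intro l u hu
  rw [Pi.sub_apply, coeff_sub] at hu
  by_cases h : coeff u (x l) = 0
  · exact hy l u fun h' => hu (by rw [h, h', sub_zero])
  · exact hx l u h

theorem eq_zero_of_degIn {T : Set ℤ} {i : ℕ} {x : R.Free i} (h : R.DegIn T x)
    (h' : R.DegIn Tᶜ x) : x = 0 := by
  ext l u
  by_contra hc
  exact h' l u hc (h l u hc)

theorem exists_degIn_diff_eq {i : ℕ} {y : ℤ} {x : R.Free i} (hx : R.DegIn {y} x)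
    (h : ∃ w, R.diff i w = x) : ∃ w, R.DegIn {y} w ∧ R.diff i w = x := by
  obtain ⟨w, rfl⟩ := h
  obtain ⟨w', h1, h2⟩ := R.exists_degIn_compl y w
  refine ⟨w', h1, ?_⟩
  have := eq_zero_of_degIn (hx.sub h1.diff) (by rw [← map_sub]; exact h2.diff)
  exact (sub_eq_zero.1 this).symm

variable (R)

/-- The differential in degree `y`. -/
noncomputable def diffPiece (y : ℤ) (i : ℕ) : R.piece y (i + 1) →ₗ[k] R.piece y i :=
  ((R.diff i).restrictScalars k).restrict fun _ hx => mem_piece.2 (mem_piece.1 hx).diff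

/-- The coefficient of degree `y` of the augmentation. -/
noncomputable def augPiece (y : ℕ) : R.piece y 0 →ₗ[k] k where
  toFun x := (R.aug x).coeff y
  map_add' x x' := by simp
  map_smul' a x := by
    have : ((a • x : R.piece y 0) : R.Free 0) =
        (C a : MvPolynomial (Fin m) k) • (x : R.Free 0) := by
      rw [Submodule.coe_smul]
      ext1 l
      simp [smul_eq_C_mul]
    rw [this, map_smulₛₗ, monomialMap_C]
    simp

variable {R}

theorem range_diffPiece_zero (y : ℕ) :
    LinearMap.range (R.diffPiece y 0) = LinearMap.ker (R.augPiece y) := by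
  ext x
  constructor
  · rintro ⟨w, rfl⟩
    change (R.aug (R.diff 0 w)).coeff y = 0
    rw [aug_diff, Polynomial.coeff_zero]
  · intro (hx : (R.aug x).coeff y = 0)
    have h1 := mem_piece.1 x.2
    have h2 := aug_eq_monomial h1
    rw [hx, Polynomial.monomial_zero_right] at h2
    obtain ⟨w, hw, hw'⟩ := exists_degIn_diff_eq h1 (R.exists_diff_zero_eq h2)
    exact ⟨⟨w, mem_piece.2 hw⟩, Subtype.ext hw'⟩

theorem range_diffPiece_succ (y : ℤ) (i : ℕ) :
    LinearMap.range (R.diffPiece y (i + 1)) = LinearMap.ker (R.diffPiece y i) := by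
  ext x
  constructor
  · rintro ⟨w, rfl⟩
    exact Subtype.ext (R.diff_diff i w)
  · intro hx
    obtain ⟨w, hw, hw'⟩ := exists_degIn_diff_eq (mem_piece.1 x.2)
      (R.exists_diff_eq (congrArg Subtype.val hx))
    exact ⟨⟨w, mem_piece.2 hw⟩, Subtype.ext hw'⟩

open Classical in
theorem finrank_range_augPiece (y : ℕ) :
    Module.finrank k (LinearMap.range (R.augPiece y)) = if y ∈ semigroup d then 1 else 0 := by
  split_ifs with hy
  · obtain ⟨x, hx⟩ := R.exists_aug_eq (monomial_mem_range hy 1)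
    obtain ⟨x', h1, h2⟩ := R.exists_degIn_compl y x
    have h3 : (R.aug x').coeff y = 1 := by
      have h4 : (R.aug (x - x')).coeff y = 0 := by
        by_contra hc
        exact h2.aug hc rfl
      rw [map_sub, hx, Polynomial.coeff_sub, Polynomial.coeff_monomial_same] at h4
      exact (sub_eq_zero.1 h4).symm
    have : LinearMap.range (R.augPiece y) = ⊤ := by
      rw [LinearMap.range_eq_top]
      intro a
      refine ⟨a • ⟨x', mem_piece.2 h1⟩, ?_⟩
      rw [map_smul]
      change a * (R.aug x').coeff y = a
      rw [h3, mul_one]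
    rw [this, finrank_top, Module.finrank_self]
  · have : R.augPiece y = 0 := by
      ext x
      by_contra hc
      exact hy (mem_semigroup_of_mem_range (R.aug_mem_range x) hc)
    rw [this, LinearMap.range_zero, finrank_bot]

open Classical in
/-- The Hilbert series of the semigroup ring, computed from the resolution. -/
theorem sum_weightCount (hd : IsMinimalSystem d) (hm : 0 < m) (y : ℤ) :
    ∑ i ∈ Finset.range m, (-1 : ℤ) ^ i * ∑ l, (weightCount d (y - R.syzDeg i l) : ℤ) =
      if IntMem d y then 1 else 0 := by
  rcases lt_or_ge y 0 with hy | hy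
  · rw [if_neg (by rintro ⟨s, -, rfl⟩; omega)]
    refine Finset.sum_eq_zero fun i _ => ?_
    rw [Finset.sum_eq_zero, mul_zero]
    intro l _
    have : {u : Fin m →₀ ℕ | (Finsupp.weight d u : ℤ) = y - R.syzDeg i l} = ∅ := by
      ext u
      simp only [Set.mem_ofPred_eq, Set.mem_empty_iff_false, iff_false]
      omega
    simp [weightCount, this]
  · lift y to ℕ using hy
    have hfin := fun i => R.finite_piece hd y i
    -- The resolution stops before index `m`, so the Euler characteristic has only the terms `i <
    -- m`.
    have hsub : Subsingleton (R.piece y m) := by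
      have : IsEmpty (Fin (R.betti m)) := by
        rw [R.betti_eq_zero le_rfl hm]; infer_instance
      infer_instance
    have h1 := sum_neg_one_pow_finrank (V := fun i => R.piece y i) (R.diffPiece y) (R.augPiece y)
      (range_diffPiece_zero y)
      (range_diffPiece_succ y) hsub
    rw [finrank_range_augPiece] at h1
    simp only [finrank_piece hd] at h1
    push_cast at h1
    rw [h1]
    refine if_congr ⟨fun h => ⟨y, h, rfl⟩, fun ⟨s, hs, h⟩ => ?_⟩ rfl rfl
    rwa [← Int.ofNat_inj.1 h]

end MinimalResolution

end NumSemi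

namespace NumSemi

/-! ### Convolution with `∏ (1 - z ^ dᵢ)` -/

section AltSum

variable {m : ℕ} (d : Fin m → ℕ)

/-- The coefficients of the product of `∏ᵢ (1 - z ^ dᵢ)` with the series with coefficients `φ`. -/
def altSum (φ : ℤ → ℤ) (y : ℤ) : ℤ :=
  ∑ A : Finset (Fin m), (-1) ^ A.card * φ (y - ∑ i ∈ A, (d i : ℤ))

variable {d}

theorem altSum_add (φ ψ : ℤ → ℤ) (y : ℤ) :
    altSum d (fun x => φ x + ψ x) y = altSum d φ y + altSum d ψ y := by
  simp [altSum, mul_add, Finset.sum_add_distrib]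

theorem altSum_sub (φ ψ : ℤ → ℤ) (y : ℤ) :
    altSum d (fun x => φ x - ψ x) y = altSum d φ y - altSum d ψ y := by
  simp [altSum, mul_sub, Finset.sum_sub_distrib]

theorem altSum_sum {ι : Type*} (s : Finset ι) (φ : ι → ℤ → ℤ) (y : ℤ) :
    altSum d (fun x => ∑ i ∈ s, φ i x) y = ∑ i ∈ s, altSum d (φ i) y := by
  simp only [altSum, Finset.mul_sum]
  exact Finset.sum_comm

theorem altSum_const_mul (c : ℤ) (φ : ℤ → ℤ) (y : ℤ) :
    altSum d (fun x => c * φ x) y = c * altSum d φ y := by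
  simp only [altSum, Finset.mul_sum]
  exact Finset.sum_congr rfl fun _ _ => by ring

theorem altSum_comp_sub (φ : ℤ → ℤ) (c y : ℤ) :
    altSum d (fun x => φ (x - c)) y = altSum d φ (y - c) := by
  simp only [altSum, sub_right_comm]

/-- The two-sided series `∑ z ^ x` is annihilated by any factor `1 - z ^ dᵢ`. Working with functions
on all of `ℤ` is what permits the reflection `x ↦ F - x`. -/
theorem altSum_one (hm : 0 < m) (y : ℤ) : altSum d (fun _ => 1) y = 0 := by
  have : Nonempty (Fin m) := ⟨⟨0, hm⟩⟩
  simpa [altSum] using Finset.sum_powerset_neg_one_pow_card_of_nonempty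
    (Finset.univ_nonempty (α := Fin m))

/-- Replacing `A` by its complement changes the sign by `(-1) ^ m` and the subset sum `s` to `Σ -
s`. -/
theorem altSum_reflect (φ : ℤ → ℤ) (c y : ℤ) :
    altSum d (fun x => φ (c - x)) y = (-1) ^ m * altSum d φ (c + genSum d - y) := by
  rw [altSum, altSum, Finset.mul_sum,
    ← Equiv.sum_comp (compl_involutive (α := Finset (Fin m))).toPerm]
  refine Finset.sum_congr rfl fun A _ => ?_
  simp only [Function.Involutive.coe_toPerm]
  have h1 : (-1 : ℤ) ^ Aᶜ.card = (-1) ^ m * (-1) ^ A.card := by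
    have h2 : (-1 : ℤ) ^ m = (-1) ^ A.card * (-1) ^ Aᶜ.card := by
      rw [← pow_add, A.card_add_card_compl, Fintype.card_fin]
    rw [h2, mul_right_comm, ← mul_pow]
    simp
  have h3 := Finset.sum_add_sum_compl A fun i => (d i : ℤ)
  rw [h1, mul_assoc, genSum, ← h3]
  congr 3
  ring

theorem weightCount_sub_sum (A : Finset (Fin m)) (y : ℤ) :
    weightCount d (y - ∑ i ∈ A, (d i : ℤ)) =
      Set.ncard {u : Fin m →₀ ℕ | (Finsupp.weight d u : ℤ) = y ∧ A ⊆ u.support} := by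
  classical
  let e : Fin m →₀ ℕ := Finsupp.equivFunOnFinite.symm fun i => if i ∈ A then 1 else 0
  have he : Finsupp.weight d e = ∑ i ∈ A, d i := by
    simp [Finsupp.weight_eq_sum, e]
  have : {u : Fin m →₀ ℕ | (Finsupp.weight d u : ℤ) = y ∧ A ⊆ u.support} =
      (· + e) '' {u | (Finsupp.weight d u : ℤ) = y - ∑ i ∈ A, (d i : ℤ)} := by
    ext u
    constructor
    · rintro ⟨h1, h2⟩
      have h3 : u - e + e = u := by
        ext i
        by_cases hi : i ∈ A
        · have := h2 hi
          rw [Finsupp.mem_support_iff] at this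
          simp [e, hi]
          omega
        · simp [e, hi]
      refine ⟨u - e, ?_, h3⟩
      rw [← h3, map_add, he] at h1
      simp only [Set.mem_ofPred_eq]
      push_cast at h1
      omega
    · rintro ⟨v, hv, rfl⟩
      refine ⟨?_, fun i hi => ?_⟩
      · simp only [Set.mem_ofPred_eq] at hv
        rw [map_add, he]
        push_cast
        omega
      · simp [e, hi]
  rw [this, Set.ncard_image_of_injective _ (add_left_injective e)]
  rfl

/-- The Hilbert series of the polynomial ring is the inverse of `∏ (1 - z ^ dᵢ)`. An exponent `u` is
counted for each `A ⊆ u.support` with sign `(-1) ^ #A`, and the signs cancel unless `u = 0`. -/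
theorem altSum_weightCount (hd : IsMinimalSystem d) (y : ℤ) :
    altSum d (fun x => (weightCount d x : ℤ)) y = if y = 0 then 1 else 0 := by
  classical
  let V := (finite_weight_eq hd.ne_zero y).toFinset
  have h1 : ∀ A : Finset (Fin m), (weightCount d (y - ∑ i ∈ A, (d i : ℤ)) : ℤ) =
      ∑ u ∈ V, if A ⊆ u.support then 1 else 0 := by
    intro A
    rw [weightCount_sub_sum, Finset.sum_boole, ← Set.ncard_coe_finset]
    congr 2
    ext u
    simp [V]
  simp only [altSum, h1, Finset.mul_sum]
  rw [Finset.sum_comm]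
  have h2 : ∀ u : Fin m →₀ ℕ, ∑ A : Finset (Fin m),
      (-1 : ℤ) ^ A.card * (if A ⊆ u.support then 1 else 0) = if u = 0 then 1 else 0 := by
    intro u
    have := Finset.sum_powerset_neg_one_pow_card (x := u.support)
    simp only [Finsupp.support_eq_empty] at this
    rw [← this]
    simp only [mul_ite, mul_one, mul_zero]
    rw [← Finset.sum_filter]
    exact Finset.sum_congr (by ext A; simp) fun _ _ => rfl
  simp only [h2]
  rw [Finset.sum_ite_eq']
  refine if_congr ?_ rfl rfl
  simp [V, eq_comm]

end AltSum

/-! ### Frobenius number, the set `Δ_H` and its shifts -/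

section Gaps

variable {m : ℕ} {d : Fin m → ℕ}

theorem mem_semigroup_of_conductor_le (hd : IsMinimalSystem d) {k : ℕ} (hk : conductor d ≤ k) :
    k ∈ semigroup d := by
  have hne : {c : ℕ | ∀ k, c ≤ k → k ∈ semigroup d}.Nonempty := by
    obtain ⟨n, hn⟩ := Nat.exists_mem_closure_of_ge (Set.range d)
    refine ⟨n, fun k hk => hn k hk ?_⟩
    have : Nat.setGcd (Set.range d) ∣ 1 := by
      rw [← hd.gcd_eq_one]
      exact Finset.dvd_gcd fun i _ => Nat.setGcd_dvd_of_mem ⟨i, rfl⟩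
    exact this.trans (one_dvd k)
  exact Nat.sInf_mem hne k hk

theorem intMem_of_frobenius_lt (hd : IsMinimalSystem d) {x : ℤ} (hx : frobenius d < x) :
    IntMem d x := by
  rw [frobenius] at hx
  exact ⟨x.toNat, mem_semigroup_of_conductor_le hd (by omega), by omega⟩

theorem not_intMem_frobenius : ¬ IntMem d (frobenius d) := by
  rintro ⟨s, hs, h⟩
  rw [frobenius] at h
  have : conductor d ≤ s := Nat.sInf_le fun k hk => by
    rcases hk.eq_or_lt with rfl | hk
    · exact hs
    · by_contra hc
      have hne : {c : ℕ | ∀ k, c ≤ k → k ∈ semigroup d}.Nonempty := by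
        -- If the set were empty, `sInf` would return `0` and `s = -1`.
        by_contra he
        rw [Set.not_nonempty_iff_eq_empty] at he
        rw [conductor, he, Nat.sInf_empty] at h
        omega
      exact hc (Nat.sInf_mem hne k (by rw [conductor] at h; omega))
  omega

theorem IntMem.add {x y : ℤ} (hx : IntMem d x) (hy : IntMem d y) : IntMem d (x + y) := by
  obtain ⟨s, hs, rfl⟩ := hx
  obtain ⟨t, ht, rfl⟩ := hy
  exact ⟨s + t, add_mem hs ht, by push_cast; rfl⟩

theorem frobenius_mem_pseudoFrobenius (hd : IsMinimalSystem d) :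
    frobenius d ∈ pseudoFrobenius d :=
  ⟨not_intMem_frobenius, fun _ _ h0 => intMem_of_frobenius_lt hd (by omega)⟩

/-- The integer `x` is an element of `Δ_H`. -/
def IsGapH (d : Fin m → ℕ) (x : ℤ) : Prop :=
  ¬ IntMem d x ∧ ¬ IntMem d (frobenius d - x)

theorem isGapH_frobenius_sub {x : ℤ} : IsGapH d (frobenius d - x) ↔ IsGapH d x := by
  rw [IsGapH, IsGapH, sub_sub_cancel, and_comm]

theorem intMem_natCast {s : ℕ} : IntMem d s ↔ s ∈ semigroup d :=
  ⟨fun ⟨_, ht, h⟩ => Int.ofNat_inj.1 h ▸ ht, fun h => ⟨s, h, rfl⟩⟩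

theorem isGapH_iff (hd : IsMinimalSystem d) {x : ℤ} :
    IsGapH d x ↔ ∃ h ∈ gapsH d, (h : ℤ) = x := by
  simp only [gapsH, Finset.mem_filter, Finset.mem_range]
  constructor
  · rintro ⟨h1, h2⟩
    have h3 : 0 ≤ x := by
      by_contra hc
      exact h2 (intMem_of_frobenius_lt hd (by omega))
    lift x to ℕ using h3
    refine ⟨x, ⟨?_, by rwa [← intMem_natCast], h2⟩, rfl⟩
    by_contra hc
    exact h1 (intMem_of_frobenius_lt hd (by rw [frobenius]; omega))
  · rintro ⟨h, ⟨-, h1, h2⟩, rfl⟩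
    exact ⟨by rwa [intMem_natCast], h2⟩

open Classical in
theorem intMem_add_intMem_frobenius_sub (x : ℤ) :
    (if IntMem d x then (1 : ℤ) else 0) + (if IntMem d (frobenius d - x) then 1 else 0) =
      1 - if IsGapH d x then 1 else 0 := by
  have : ¬ (IntMem d x ∧ IntMem d (frobenius d - x)) := fun ⟨h1, h2⟩ =>
    not_intMem_frobenius (d := d) (by simpa using h1.add h2)
  by_cases h1 : IntMem d x <;> by_cases h2 : IntMem d (frobenius d - x) <;>
    simp_all [IsGapH]

theorem IsAlmostSymmetric.mem_pseudoFrobenius_iff (hS : IsAlmostSymmetric d)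
    (hd : IsMinimalSystem d) {x : ℤ} :
    x ∈ pseudoFrobenius d ↔ x = frobenius d ∨ IsGapH d x := by
  have h := Set.ext_iff.1 hS x
  simp only [Set.mem_sdiff, Set.mem_singleton_iff, Set.mem_image, Finset.mem_coe] at h
  rw [isGapH_iff hd, ← h]
  by_cases hx : x = frobenius d
  · simp [hx, frobenius_mem_pseudoFrobenius hd]
  · simp [hx]

theorem not_isGapH_frobenius : ¬ IsGapH d (frobenius d) := fun h =>
  h.2 ⟨0, zero_mem _, by simp⟩

open Classical in
theorem count_shiftedSums (hd : IsMinimalSystem d) (i : ℕ) (y : ℤ) :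
    ((shiftedSums d i).count y : ℤ) = ∑ A ∈ Finset.powersetCard i Finset.univ,
      if IsGapH d (y - ∑ j ∈ A, (d j : ℤ)) then 1 else 0 := by
  have h1 : shiftedSums d i = (Finset.powersetCard i (Finset.univ : Finset (Fin m))).val.bind
      fun A => (gapsH d).val.map fun h : ℕ => ∑ j ∈ A, (d j : ℤ) + h := by
    simp [shiftedSums, genSums, SProd.sprod, Multiset.product, Multiset.map_bind,
      Multiset.bind_map]
  rw [h1, Multiset.count_bind]
  change ((∑ A ∈ Finset.powersetCard i (Finset.univ : Finset (Fin m)), _ : ℕ) : ℤ) = _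
  push_cast
  refine Finset.sum_congr rfl fun A _ => ?_
  have h2 : ((gapsH d).val.map fun h : ℕ => ∑ j ∈ A, (d j : ℤ) + h).Nodup :=
    (gapsH d).nodup.map fun a b h => by simpa using h
  rw [Multiset.count_eq_of_nodup h2]
  push_cast
  refine if_congr ?_ rfl rfl
  rw [isGapH_iff hd]
  simp only [Multiset.mem_map, Finset.mem_val, eq_sub_iff_add_eq']

theorem card_shiftedSums (i : ℕ) : (shiftedSums d i).card = m.choose i * gamma d := by
  simp [shiftedSums, genSums, gamma]

open Classical in
theorem altSum_isGapH (hd : IsMinimalSystem d) (y : ℤ) :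
    altSum d (fun x => if IsGapH d x then 1 else 0) y =
      ∑ i ∈ Finset.range (m + 1), (-1) ^ i * ((shiftedSums d i).count y : ℤ) := by
  rw [altSum, ← Finset.powerset_univ, Finset.sum_powerset, Finset.card_univ, Fintype.card_fin]
  refine Finset.sum_congr rfl fun i _ => ?_
  rw [count_shiftedSums hd, Finset.mul_sum]
  refine Finset.sum_congr rfl fun A hA => ?_
  rw [(Finset.mem_powersetCard.1 hA).2]

end Gaps

theorem altSum_intMem {k : Type*} [Field k] {m : ℕ} {d : Fin m → ℕ} (R : MinimalResolution k d)
    [DecidablePred (IntMem d)] (hd : IsMinimalSystem d) (hm : 0 < m) (y : ℤ) :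
    altSum d (fun x => if IntMem d x then 1 else 0) y =
      ∑ i ∈ Finset.range m, (-1) ^ i * ((R.degrees i).count y : ℤ) := by
  have h1 : (fun x => if IntMem d x then (1 : ℤ) else 0) = fun x =>
      ∑ i ∈ Finset.range m, (-1 : ℤ) ^ i * ∑ l, (weightCount d (x - R.syzDeg i l) : ℤ) := by
    ext x
    rw [R.sum_weightCount hd hm]
    congr
  rw [h1, altSum_sum]
  refine Finset.sum_congr rfl fun i _ => ?_
  rw [altSum_const_mul, altSum_sum]
  congr 1
  rw [MinimalResolution.degrees, Multiset.count_map, ← Finset.filter_val, Finset.card_val,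
    Finset.card_filter]
  push_cast
  refine Finset.sum_congr rfl fun l _ => ?_
  rw [altSum_comp_sub (fun x => (weightCount d x : ℤ)), altSum_weightCount hd]
  simp only [sub_eq_zero]

end NumSemi

/-! ### The multiset identity and the count -/

namespace NumSemi

theorem sum_range_two_mul {M : Type*} [AddCommMonoid M] (f : ℕ → M) {n : ℕ} (hn : 1 ≤ n) :
    ∑ i ∈ Finset.range (2 * n), f i = f 0 + ∑ q ∈ Finset.Icc 1 (n - 1), f (2 * q - 1) +
      ∑ q ∈ Finset.Icc 1 (n - 1), f (2 * q) + f (2 * n - 1) := by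
  obtain ⟨p, rfl⟩ : ∃ p, n = p + 1 := ⟨n - 1, by omega⟩
  rw [Nat.add_sub_cancel]
  clear hn
  induction p with
  | zero => simp [Finset.sum_range_succ]
  | succ p ih =>
    rw [show 2 * (p + 1 + 1) = 2 * (p + 1) + 1 + 1 by ring, Finset.sum_range_succ,
      Finset.sum_range_succ, ih, Finset.sum_Icc_succ_top (by omega),
      Finset.sum_Icc_succ_top (by omega)]
    simp only [Nat.add_sub_cancel]
    abel

theorem sum_range_two_mul_neg_one_pow (f : ℕ → ℤ) {n : ℕ} (hn : 1 ≤ n) :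
    ∑ i ∈ Finset.range (2 * n), (-1) ^ i * f i = f 0 - ∑ q ∈ Finset.Icc 1 (n - 1), f (2 * q - 1) +
      ∑ q ∈ Finset.Icc 1 (n - 1), f (2 * q) - f (2 * n - 1) := by
  have hodd : ∀ q, 1 ≤ q → (-1 : ℤ) ^ (2 * q - 1) = -1 := fun q hq =>
    Odd.neg_one_pow ⟨q - 1, by omega⟩
  rw [sum_range_two_mul _ hn, hodd n hn]
  have h1 : ∑ q ∈ Finset.Icc 1 (n - 1), (-1 : ℤ) ^ (2 * q - 1) * f (2 * q - 1) =
      - ∑ q ∈ Finset.Icc 1 (n - 1), f (2 * q - 1) := by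
    rw [← Finset.sum_neg_distrib]
    exact Finset.sum_congr rfl fun q hq => by
      rw [hodd q (Finset.mem_Icc.1 hq).1, neg_one_mul]
  rw [h1]
  simp only [pow_mul, neg_one_sq, one_pow, one_mul, pow_zero]
  ring

theorem sum_Icc_pred_add {M : Type*} [AddCommMonoid M] (f : ℕ → M) {n : ℕ} (hn : 1 ≤ n) :
    ∑ q ∈ Finset.Icc 1 n, f q = ∑ q ∈ Finset.Icc 1 (n - 1), f q + f n := by
  obtain ⟨p, rfl⟩ : ∃ p, n = p + 1 := ⟨n - 1, by omega⟩
  rw [Nat.add_sub_cancel, Finset.sum_Icc_succ_top (by omega)]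

/-- The hypothesis makes the truncated differences `s - t` and `s' - t'` equal, and removing the
intersection from `s` leaves `s - t`. -/
theorem card_inter_of_add_eq_add {α : Type*} [DecidableEq α] {s t s' t' : Multiset α}
    (h : s + t' = s' + t) :
    s.card + (s' ∩ t').card = s'.card + (s ∩ t).card := by
  have h1 : s - t = s' - t' := by
    ext a
    have := congrArg (Multiset.count a) h
    rw [Multiset.count_add, Multiset.count_add] at this
    rw [Multiset.count_sub, Multiset.count_sub]
    omega
  have h2 := congrArg Multiset.card (Multiset.sub_add_inter s t)
  have h3 := congrArg Multiset.card (Multiset.sub_add_inter s' t')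
  rw [Multiset.card_add] at h2 h3
  rw [h1] at h2
  omega

theorem MinimalResolution.count_dualDegrees {k : Type*} [Field k] {m : ℕ} {d : Fin m → ℕ}
    (R : MinimalResolution k d) (i : ℕ) (y : ℤ) :
    (R.dualDegrees i).count y = (R.degrees i).count (frobenius d + genSum d - y) := by
  rw [dualDegrees]
  conv_lhs => rw [← sub_sub_cancel (frobenius d + genSum d) y]
  exact Multiset.count_map_eq_count' (fun c => frobenius d + genSum d - c) _
    sub_right_injective _

variable {k : Type*} [Field k] {n : ℕ} {d : Fin (2 * n) → ℕ} (R : MinimalResolution k d)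

theorem evenDegrees_add_oddSums (hn : 1 ≤ n) (hd : IsMinimalSystem d)
    (hS : IsAlmostSymmetric d) :
    evenDegrees R + evenSums d = oddDegrees R + oddSums d := by
  classical
  ext y
  have hm : 0 < 2 * n := by omega
  have hl : 2 * n - 1 + 1 = 2 * n := by omega
  have h1 : altSum d (fun x => (if IntMem d x then (1 : ℤ) else 0) +
      (if IntMem d (frobenius d - x) then 1 else 0)) y =
      altSum d (fun x => 1 - if IsGapH d x then 1 else 0) y := by
    simp only [intMem_add_intMem_frobenius_sub]
  rw [altSum_add, altSum_sub, altSum_one hm, altSum_isGapH hd, Finset.sum_range_succ,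
    altSum_reflect (fun x => if IntMem d x then 1 else 0), altSum_intMem R hd hm,
    altSum_intMem R hd hm, sum_range_two_mul_neg_one_pow _ hn, sum_range_two_mul_neg_one_pow _ hn,
    sum_range_two_mul_neg_one_pow _ hn, count_shiftedSums hd 0, count_shiftedSums hd (2 * n),
    R.count_degrees_top hd hl, R.count_degrees_top hd hl, R.degrees_zero] at h1
  have hfull : Finset.powersetCard (2 * n) (Finset.univ : Finset (Fin (2 * n))) =
      {Finset.univ} := by
    have := Finset.powersetCard_self (Finset.univ : Finset (Fin (2 * n)))
    rwa [Finset.card_univ, Fintype.card_fin] at this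
  rw [hfull, Finset.powersetCard_zero, Finset.sum_singleton, Finset.sum_singleton,
    Finset.sum_empty, sub_zero, ← genSum] at h1
  have e1 : frobenius d + genSum d - y - genSum d = frobenius d - y := by ring
  simp only [Multiset.count_singleton, pow_mul, neg_one_sq, one_pow, one_mul, e1,
    hS.mem_pseudoFrobenius_iff hd, isGapH_frobenius_sub] at h1
  -- The alternatives exclude each other, since `0 ∈ S` keeps `F` out of `Δ_H`. The `F` parts will
  -- cancel the degree of `F₀` and its dual, the `Δ_H` parts `𝔏₀` and `𝔏_{2n}`.
  have e2 : ∀ x : ℤ, (((if x = frobenius d ∨ IsGapH d x then 1 else 0 : ℕ)) : ℤ) =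
      (if x = frobenius d then 1 else 0) + if IsGapH d x then 1 else 0 := by
    intro x
    by_cases hx : x = frobenius d
    · simp [hx, not_isGapH_frobenius]
    · simp [hx]
  have e3 : (((if frobenius d - y = frobenius d ∨ IsGapH d y then 1 else 0 : ℕ)) : ℤ) =
      (if y = 0 then 1 else 0) + if IsGapH d y then 1 else 0 := by
    have := e2 (frobenius d - y)
    simpa only [isGapH_frobenius_sub, sub_eq_self] using this
  rw [e2, e3] at h1
  have e4 : (y - genSum d = frobenius d) ↔ (frobenius d + genSum d - y = 0) := by
    constructor <;> intro h <;> linarith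
  simp only [e4] at h1
  push_cast at h1
  rw [Multiset.count_add, Multiset.count_add, evenDegrees, evenSums, oddDegrees, oddSums,
    show 2 * n / 2 = n by omega, show (2 * n - 1) / 2 = n - 1 by omega, sum_Icc_pred_add _ hn]
  simp only [Multiset.count_add, Multiset.count_sum', Finset.sum_add_distrib,
    R.count_dualDegrees]
  zify
  linarith

theorem card_degrees (i : ℕ) : (R.degrees i).card = R.betti i := by
  simp [MinimalResolution.degrees]

theorem card_oddDegrees :
    (oddDegrees R).card = 2 * ∑ q ∈ Finset.Icc 1 (n - 1), R.betti (2 * q - 1) := by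
  rw [oddDegrees, Multiset.card_sum, Finset.mul_sum]
  refine Finset.sum_congr rfl fun q _ => ?_
  rw [Multiset.card_add, MinimalResolution.dualDegrees, Multiset.card_map, card_degrees]
  exact (two_mul _).symm

theorem card_evenDegrees :
    (evenDegrees R).card = 2 * ∑ q ∈ Finset.Icc 1 (n - 1), R.betti (2 * q) := by
  rw [evenDegrees, Multiset.card_sum, Finset.mul_sum]
  refine Finset.sum_congr rfl fun q _ => ?_
  rw [Multiset.card_add, MinimalResolution.dualDegrees, Multiset.card_map, card_degrees]
  exact (two_mul _).symm

theorem card_oddSums_evenSums (hn : 1 ≤ n) :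
    ((oddSums d).card : ℤ) = 2 * (gamma d * 4 ^ (n - 1)) ∧
      ((evenSums d).card : ℤ) = 2 * (gamma d * (4 ^ (n - 1) - 1)) := by
  set a : ℤ := ∑ q ∈ Finset.Icc 1 (n - 1), ((2 * n).choose (2 * q - 1) : ℤ) with ha
  set b : ℤ := ∑ q ∈ Finset.Icc 1 (n - 1), ((2 * n).choose (2 * q) : ℤ) with hb
  have hodd : ((oddSums d).card : ℤ) = (a + 2 * n) * gamma d := by
    rw [oddSums, show 2 * n / 2 = n by omega, sum_Icc_pred_add _ hn, Multiset.card_add,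
      Multiset.card_sum]
    simp only [card_shiftedSums]
    have : (2 * n).choose (2 * n - 1) = 2 * n := by
      rw [Nat.choose_symm (n := 2 * n) (k := 1) (by omega), Nat.choose_one_right]
    rw [this, ← Finset.sum_mul, ha]
    push_cast
    ring
  have heven : ((evenSums d).card : ℤ) = b * gamma d := by
    rw [evenSums, show (2 * n - 1) / 2 = n - 1 by omega, Multiset.card_sum]
    simp only [card_shiftedSums]
    rw [← Finset.sum_mul, hb]
    push_cast
    ring
  have hch : (2 * n).choose (2 * n - 1) = 2 * n := by
    rw [Nat.choose_symm (n := 2 * n) (k := 1) (by omega), Nat.choose_one_right]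
  -- The full and the alternating sum of row `2n` of Pascal's triangle determine `a` and `b`; the
  -- summands `1`, `2n`, `1` are the entries at `0`, `2n - 1`, `2n`.
  have h1 : (1 : ℤ) + a + b + 2 * n + 1 = 4 * 4 ^ (n - 1) := by
    have h := Nat.sum_range_choose (2 * n)
    rw [Finset.sum_range_succ, sum_range_two_mul _ hn, hch, Nat.choose_zero_right,
      Nat.choose_self] at h
    zify at h
    rw [ha, hb, h, pow_mul, ← pow_succ', Nat.sub_add_cancel hn]
    norm_num
  have h2 : (1 : ℤ) - a + b - 2 * n + 1 = 0 := by
    have h := Int.alternating_sum_range_choose_of_ne (n := 2 * n) (by omega)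
    rw [Finset.sum_range_succ, sum_range_two_mul_neg_one_pow _ hn, hch, Nat.choose_zero_right,
      Nat.choose_self, pow_mul] at h
    rw [ha, hb, ← h]
    push_cast
    norm_num
  rw [hodd, heven]
  constructor
  · rw [show a + 2 * n = 2 * 4 ^ (n - 1) by linarith]; ring
  · rw [show b = 2 * (4 ^ (n - 1) - 1) by linarith]; ring

end NumSemi

theorem theorem5 {k : Type*} [Field k] [CharZero k] (n : ℕ) (hn : 1 ≤ n)
    (d : Fin (2 * n) → ℕ) (hd : NumSemi.IsMinimalSystem d)
    (hS : NumSemi.IsAlmostSymmetric d) (R : NumSemi.MinimalResolution k d) :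
    ∑ q ∈ Finset.Icc 1 (n - 1), (R.betti (2 * q - 1) : ℚ) =
        (NumSemi.gamma d : ℚ) * (4 ^ (n - 1) - 1) + (NumSemi.delta R : ℚ) / 2 ∧
      ∑ q ∈ Finset.Icc 1 (n - 1), (R.betti (2 * q) : ℚ) =
        (NumSemi.gamma d : ℚ) * 4 ^ (n - 1) + (NumSemi.delta R : ℚ) / 2 := by
  have h := NumSemi.evenDegrees_add_oddSums R hn hd hS
  have h1 := NumSemi.card_inter_of_add_eq_add (h.trans (add_comm _ _))
  have h2 := NumSemi.card_inter_of_add_eq_add (h.symm.trans (add_comm _ _))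
  obtain ⟨h3, h4⟩ := NumSemi.card_oddSums_evenSums (d := d) hn
  rw [NumSemi.card_evenDegrees, Multiset.inter_comm, Multiset.inter_comm (NumSemi.evenDegrees R),
    ← NumSemi.ell, ← NumSemi.wp] at h1
  rw [NumSemi.card_oddDegrees, ← NumSemi.ell, ← NumSemi.wp] at h2
  zify at h1 h2
  rw [h3] at h1
  rw [h4] at h2
  qify at h1 h2
  simp only [NumSemi.delta]
  push_cast
  constructor <;> linarith
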